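/- Let $m\in\mathbb{Z}$ be a cube-free integer with $m^2\not\equiv 1\pmod 9$, and write $m=hk^2$ with $h,k\in\mathbb{Z}$ square-free and coprime. Let $K=\mathbb{Q}(\theta)$ with $\theta^3=m$, let $p\neq 2,3$ be a prime number and let $n\geq 0$ be an integer. Let $r_p$ be the number of distinct roots of $X^3-m$ in $\mathbb{Z}/p\mathbb{Z}$. An order of $K$ is a subring of $K$ that is a finitely generated $\mathbb{Z}$-module of rank $[K:\mathbb{Q}]=3$; its index is its index in the ring of integers $\mathcal{O}_K$ as a subgroup. Put $$C_{p,n}=\begin{cases}\dfrac{p^{\lfloor n/3\rfloor+1}-1}{p-1} & \text{if } p\mid m,\\[2ex] \dfrac{p^{\lfloor 2n/3\rfloor-\lceil n/3\rceil+1}-1}{p-1}+\dfrac{p^{\lceil n/3\rceil}-1}{p-1}\,r_p & \text{if } p\nmid m.\end{cases}$$ Then $K$ has exactly $C_{p,n}$ orders of index $p^n$. Moreover, $(1,\theta,\theta^2/k)$ is a $\mathbb{Z}$-basis of $\mathcal{O}_K$, and for this basis, and more generally for every ordered $\mathbb{Z}$-basis $(\alpha_1,\alpha_2,\alpha_3)$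 of $\mathcal{O}_K$ with $\alpha_1=1$, there are exactly $C_{p,n}$ lower triangular integer matrices $M=(a_{ij})_{1\leq i,j\leq 3}$ with $a_{ij}\geq 0$ for all $i,j$, with $a_{ij}<a_{jj}$ for $i>j$, and with $\det M=p^n$, such that the $\mathbb{Z}$-span of the elements $v_i=\sum_j a_{ij}\alpha_j$ $(1\leq i\leq 3)$ is an order of $K$. -/

import Mathlib

open scoped NumberField

/-- Integer matrices in (lower triangular) Hermite normal form. -/
def hermiteNormalForms (d : ℕ) : Set (Matrix (Fin d) (Fin d) ℤ) :=
  {M | (∀ i j, 0 ≤ M i j) ∧ (∀ i j, i < j → M i j = 0) ∧ ∀ i j, j < i → M i j < M j j}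

section NumberFields

variable (K : Type*) [Field K] [NumberField K]

/-- The ring of integers of `K`, as a `ℤ`-submodule of `K`. -/
def maximalOrder : Submodule ℤ K :=
  Subalgebra.toSubmodule (integralClosure ℤ K)

variable {K}

/-- A `ℤ`-submodule of the number field `K` is an order if it is (the underlying module of) a
subring of `K` which is finitely generated over `ℤ`, of rank `[K : ℚ]`. -/
def IsOrder (L : Submodule ℤ K) : Prop :=
  (∃ S : Subring K, (S : Set K) = (L : Set K)) ∧ L.FG ∧
    Module.finrank ℤ L = Module.finrank ℚ K

/-- The family `α` is an ordered `ℤ`-basis of the ring of integers of `K`. -/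
def IsIntegralBasis {d : ℕ} (α : Fin d → K) : Prop :=
  LinearIndependent ℤ α ∧ Submodule.span ℤ (Set.range α) = maximalOrder K

variable (K) in
/-- The orders of `K` of index `N` in the ring of integers (every order is contained in the ring
of integers, so that the relative index is the index). -/
def ordersOfIndex (N : ℕ) : Set (Submodule ℤ K) :=
  {L | IsOrder L ∧ L.toAddSubgroup.relIndex (maximalOrder K).toAddSubgroup = N}

/-- The `ℤ`-submodule spanned by the entries of the column vector `M α`. -/
def latticeOfMatrix {d : ℕ} (α : Fin d → K) (M : Matrix (Fin d) (Fin d) ℤ) : Submodule ℤ K :=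
  Submodule.span ℤ (Set.range fun i => ∑ j, M i j • α j)

/-- The matrices in Hermite normal form, of determinant `N`, whose lattice with respect to `α` is
an order. -/
def hermiteOrders {d : ℕ} (α : Fin d → K) (N : ℕ) : Set (Matrix (Fin d) (Fin d) ℤ) :=
  {M | M ∈ hermiteNormalForms d ∧ M.det = (N : ℤ) ∧ IsOrder (latticeOfMatrix α M)}

end NumberFields

/-- The number of distinct roots of `X ^ 3 - m` in `ℤ / pℤ`. -/
noncomputable def cubeRootCount (p : ℕ) (m : ℤ) : ℕ :=
  {x : ZMod p | x ^ 3 - (m : ZMod p) = 0}.ncard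

/-- The closed formula, as a rational number. -/
noncomputable def pureCubicOrderCount (m : ℤ) (p n : ℕ) : ℚ :=
  open Classical in
  if (p : ℤ) ∣ m then
    ((p : ℚ) ^ (⌊(n : ℚ) / 3⌋ + 1) - 1) / ((p : ℚ) - 1)
  else
    ((p : ℚ) ^ (⌊(2 * n : ℚ) / 3⌋ - ⌈(n : ℚ) / 3⌉ + 1) - 1) / ((p : ℚ) - 1) +
      ((p : ℚ) ^ ⌈(n : ℚ) / 3⌉ - 1) / ((p : ℚ) - 1) * (cubeRootCount p m : ℚ)

/-! Every order contains 1 and lies in the ring of integers. In a basis starting with 1 its Hermite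
normal form therefore has first row and first column (1, 0, 0), and what remains is a triple (a, b,
c) with 0 ≤ b < a and ac equal to the index. Orders and matrices are both in bijection with these
triples (`ordersOfIndex_eq_image`, `hermiteOrders_eq_image`). Since the set of orders does not
involve the basis, the count made in one basis serves for all.

In the basis 1, ω = θ, ψ = θ²/k, being a ring becomes `CubicClosed`. Put a = p^i, c = p^j with i + j
= n, and let η, κ be the exponents of p in h, k. If i ≤ 2j + η, the term hc³ is divisible by ac, and
only a divisibility of b by a power of p is left. If i > 2j + η and p ∣ m, the valuations of kb³ and
hc³ differ modulo 3, so nothing survives. If i > 2j and p ∤ m, then b = p^j u with ku³ ≡ h modulo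
p^(i - 2j), which by Hensel has r_p solutions because p ≠ 3. Summing over i gives the geometric
sums.

That 1, ω, ψ is an integral basis is shown by removing primes q from a common denominator. Traces
suffice if q ∤ 3hk. For the other primes the norm form behaves as for an Eisenstein polynomial; at 3
this is where m² ≢ 1 mod 9 enters. -/

/-- Closure under multiplication of the lattice spanned by `1`, `a ω`, `b ω + c ψ`, where
`ω ^ 2 = k ψ`, `ω ψ = h k` and `ψ ^ 2 = h ω`. -/
def CubicClosed (h k a b c : ℤ) : Prop :=
  c ∣ a ^ 2 * k ∧ c ∣ a * b * k ∧ c ∣ b ^ 2 * k ∧ a * c ∣ k * b ^ 3 - h * c ^ 3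

/-! ### Divisibility by prime powers -/

theorem Prime.pow_dvd_pow_mul_iff {p : ℤ} (hp : Prime p) {u : ℤ} (hu : ¬ p ∣ u) (e f : ℕ) :
    p ^ e ∣ p ^ f * u ↔ e ≤ f := by
  constructor
  · intro H
    have hc : IsCoprime (p ^ e) u := ((Prime.coprime_iff_not_dvd hp).2 hu).pow_left
    exact (pow_dvd_pow_iff hp.ne_zero hp.not_isUnit).1 (hc.dvd_of_dvd_mul_right H)
  · intro H
    exact (pow_dvd_pow p H).mul_right u

theorem Prime.exists_eq_pow_mul {p : ℤ} (hp : Prime p) {b : ℤ} (hb : b ≠ 0) :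
    ∃ (β : ℕ) (u : ℤ), ¬ p ∣ u ∧ b = p ^ β * u := by
  obtain ⟨u, hu, h⟩ := (FiniteMultiplicity.of_prime_left hp hb).exists_eq_pow_mul_and_not_dvd
  exact ⟨_, u, h, hu⟩

theorem Prime.not_dvd_cube {p : ℤ} (hp : Prime p) {u : ℤ} (hu : ¬ p ∣ u) : ¬ p ∣ u ^ 3 :=
  fun H => hu (hp.dvd_of_dvd_pow H)

theorem Prime.pow_dvd_cube_iff {p : ℤ} (hp : Prime p) (e : ℕ) (b : ℤ) :
    p ^ e ∣ b ^ 3 ↔ p ^ ((e + 2) / 3) ∣ b := by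
  rcases eq_or_ne b 0 with rfl | hb
  · simp
  obtain ⟨β, u, hu, rfl⟩ := hp.exists_eq_pow_mul hb
  rw [mul_pow, ← pow_mul, hp.pow_dvd_pow_mul_iff (hp.not_dvd_cube hu),
    hp.pow_dvd_pow_mul_iff hu]
  omega

/-! ### The closure conditions at prime powers -/

section Local

variable {p : ℤ} (hp : Prime p) {h' k' : ℤ} (hh' : ¬ p ∣ h') (hk' : ¬ p ∣ k') {κ η i j : ℕ}

include hp hk' in
-- Here ac divides hc³, so the last condition reduces to ac ∣ kb³, a lower bound on the valuation of
-- b. This bound and j ≤ 2i + κ imply the two middle conditions. The truncation in i + j - κ is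
-- harmless: it occurs only for i + j = 0.
theorem cubicClosed_iff_of_le (hκ : κ ≤ 1) (hij : i ≤ 2 * j + η) (b : ℤ) :
    CubicClosed (p ^ η * h') (p ^ κ * k') (p ^ i) b (p ^ j) ↔
      j ≤ 2 * i + κ ∧ p ^ ((i + j - κ + 2) / 3) ∣ b := by
  have hlast : p ^ i * p ^ j ∣ p ^ κ * k' * b ^ 3 - p ^ η * h' * (p ^ j) ^ 3 ↔
      p ^ ((i + j - κ + 2) / 3) ∣ b := by
    have h1 : p ^ i * p ^ j ∣ p ^ η * h' * (p ^ j) ^ 3 := by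
      rw [← pow_add, show p ^ η * h' * (p ^ j) ^ 3 = p ^ (η + j * 3) * h' by ring]
      exact (pow_dvd_pow p (by omega)).mul_right _
    rw [dvd_sub_left h1, ← hp.pow_dvd_cube_iff, ← pow_add]
    have hc : IsCoprime (p ^ (i + j - κ)) k' := ((Prime.coprime_iff_not_dvd hp).2 hk').pow_left
    rcases le_or_gt κ (i + j) with hle | hlt
    · obtain ⟨e, he⟩ := Nat.exists_eq_add_of_le hle
      have he' : i + j - κ = e := by omega
      rw [he'] at hc ⊢
      rw [he, pow_add, mul_assoc, mul_dvd_mul_iff_left (pow_ne_zero _ hp.ne_zero)]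
      exact ⟨hc.dvd_of_dvd_mul_left, fun H => H.mul_left _⟩
    · have : i + j = 0 := by omega
      simp [this]
  constructor
  · rintro ⟨h1, -, -, h4⟩
    refine ⟨?_, hlast.1 h4⟩
    rw [show (p ^ i) ^ 2 * (p ^ κ * k') = p ^ (2 * i + κ) * k' by ring] at h1
    exact (hp.pow_dvd_pow_mul_iff hk' _ _).1 h1
  · rintro ⟨h1, h2⟩
    refine ⟨?_, ?_, ?_, hlast.2 h2⟩
    · rw [show (p ^ i) ^ 2 * (p ^ κ * k') = p ^ (2 * i + κ) * k' by ring]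
      exact (pow_dvd_pow p h1).mul_right _
    · obtain ⟨t, rfl⟩ := h2
      rw [show ∀ s, p ^ i * (p ^ s * t) * (p ^ κ * k') = p ^ (i + s + κ) * (t * k') by
        intro s; ring]
      exact (pow_dvd_pow p (by omega)).mul_right _
    · obtain ⟨t, rfl⟩ := h2
      rw [show ∀ s, (p ^ s * t) ^ 2 * (p ^ κ * k') = p ^ (2 * s + κ) * (t ^ 2 * k') by
        intro s; ring]
      exact (pow_dvd_pow p (by omega)).mul_right _

include hp hh' hk' in
-- The valuations of kb³ and hc³ are κ and η modulo 3, hence distinct. Their difference thus has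
-- valuation at most η + 3j, which is less than i + j.
theorem not_cubicClosed_of_gt (hκη : κ + η = 1) (hij : 2 * j + η < i) (b : ℤ) :
    ¬ CubicClosed (p ^ η * h') (p ^ κ * k') (p ^ i) b (p ^ j) := by
  rintro ⟨-, -, -, h4⟩
  rw [← pow_add, show p ^ η * h' * (p ^ j) ^ 3 = p ^ (η + 3 * j) * h' by ring] at h4
  rcases eq_or_ne b 0 with rfl | hb
  · have : p ^ (i + j) ∣ p ^ (η + 3 * j) * h' := by simpa using h4
    have := (hp.pow_dvd_pow_mul_iff hh' _ _).1 this
    omega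
  obtain ⟨β, u, hu, rfl⟩ := hp.exists_eq_pow_mul hb
  have hku : ¬ p ∣ k' * u ^ 3 := fun H => (hp.dvd_or_dvd H).elim hk' (hp.not_dvd_cube hu)
  rw [show p ^ κ * k' * (p ^ β * u) ^ 3 = p ^ (κ + 3 * β) * (k' * u ^ 3) by ring] at h4
  rcases lt_or_gt_of_ne (show κ + 3 * β ≠ η + 3 * j by omega) with hlt | hlt
  · have h5 : p ^ (κ + 3 * β + 1) ∣ p ^ (κ + 3 * β) * (k' * u ^ 3) :=
      (dvd_sub_left ((pow_dvd_pow p hlt).mul_right _)).1 ((pow_dvd_pow p (by omega)).trans h4)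
    have := (hp.pow_dvd_pow_mul_iff hku _ _).1 h5
    omega
  · have h5 : p ^ (η + 3 * j + 1) ∣ p ^ (η + 3 * j) * h' :=
      (dvd_sub_right ((pow_dvd_pow p hlt).mul_right _)).1 ((pow_dvd_pow p (by omega)).trans h4)
    have := (hp.pow_dvd_pow_mul_iff hh' _ _).1 h5
    omega

include hp hk' in
-- Now c³ ∣ ac, so c³ ∣ kb³ and c ∣ b; cancelling c³ leaves a cubic congruence.
theorem cubicClosed_iff_of_gt (hij : 2 * j < i) (b : ℤ) :
    CubicClosed h' k' (p ^ i) b (p ^ j) ↔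
      ∃ u, b = p ^ j * u ∧ p ^ (i - 2 * j) ∣ k' * u ^ 3 - h' := by
  obtain ⟨e, rfl⟩ := Nat.exists_eq_add_of_le hij.le
  have key (u : ℤ) : p ^ (2 * j + e) * p ^ j ∣ k' * (p ^ j * u) ^ 3 - h' * (p ^ j) ^ 3 ↔
      p ^ e ∣ k' * u ^ 3 - h' := by
    rw [show p ^ (2 * j + e) * p ^ j = (p ^ j) ^ 3 * p ^ e by ring,
      show k' * (p ^ j * u) ^ 3 - h' * (p ^ j) ^ 3 = (p ^ j) ^ 3 * (k' * u ^ 3 - h') by ring,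
      mul_dvd_mul_iff_left (pow_ne_zero _ (pow_ne_zero _ hp.ne_zero))]
  rw [Nat.add_sub_cancel_left]
  constructor
  · rintro ⟨-, -, -, h4⟩
    have h5 : (p ^ j) ^ 3 ∣ k' * b ^ 3 := by
      refine (dvd_sub_left (Dvd.intro_left h' rfl)).1 (dvd_trans ?_ h4)
      rw [← pow_mul, ← pow_add]
      exact pow_dvd_pow p (by omega)
    have hc : IsCoprime ((p ^ j) ^ 3) k' :=
      ((Prime.coprime_iff_not_dvd hp).2 hk').pow_left.pow_left
    obtain ⟨u, rfl⟩ := (Int.pow_dvd_pow_iff (by norm_num)).1 (hc.dvd_of_dvd_mul_left h5)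
    exact ⟨u, rfl, (key u).1 h4⟩
  · rintro ⟨u, rfl, hu⟩
    refine ⟨?_, ?_, ?_, (key u).2 hu⟩
    · rw [← pow_mul]
      exact (pow_dvd_pow p (by omega)).mul_right _
    · exact ((Dvd.intro _ rfl).mul_left _).mul_right _
    · rw [mul_pow, sq, mul_assoc, mul_assoc]
      exact Dvd.intro _ rfl

end Local

/-! ### Counting in intervals -/

theorem card_filter_pow_dvd {p : ℕ} (hp : 0 < p) {s i : ℕ} (hs : s ≤ i) :
    ((Finset.range (p ^ i)).filter fun b : ℕ => (p : ℤ) ^ s ∣ (b : ℤ)).card = p ^ (i - s) := by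
  obtain ⟨e, rfl⟩ := Nat.exists_eq_add_of_le hs
  rw [Nat.add_sub_cancel_left]
  have : (Finset.range (p ^ (s + e))).filter (fun b : ℕ => (p : ℤ) ^ s ∣ (b : ℤ)) =
      (Finset.range (p ^ e)).image (p ^ s * ·) := by
    ext b
    simp only [Finset.mem_filter, Finset.mem_range, Finset.mem_image]
    constructor
    · rintro ⟨h1, h2⟩
      obtain ⟨u, rfl⟩ : p ^ s ∣ b := by exact_mod_cast h2
      rw [pow_add] at h1
      exact ⟨u, lt_of_mul_lt_mul_left h1 (Nat.zero_le _), rfl⟩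
    · rintro ⟨u, hu, rfl⟩
      rw [pow_add]
      exact ⟨Nat.mul_lt_mul_of_pos_left hu (pow_pos hp s), by push_cast; exact Dvd.intro _ rfl⟩
  rw [this, Finset.card_image_of_injective _
    (fun x y hxy => Nat.eq_of_mul_eq_mul_left (pow_pos hp s) hxy), Finset.card_range]

theorem Nat.count_mul_of_periodic {Q : ℕ → Prop} [DecidablePred Q] {q : ℕ}
    (hQ : ∀ u, Q (u + q) ↔ Q u) (t : ℕ) : Nat.count Q (q * t) = t * Nat.count Q q := by
  have hQ' : ∀ t u, Q (q * t + u) ↔ Q u := by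
    intro t
    induction t with
    | zero => simp
    | succ t ih =>
      intro u
      rw [show q * (t + 1) + u = (q * t + u) + q by ring, hQ, ih]
  induction t with
  | zero => simp
  | succ t ih =>
    rw [Nat.mul_succ, Nat.count_add, ih, Nat.succ_mul]
    simp_rw [hQ' t]

/-! ### Roots of the cubic congruence -/

section Hensel

variable {p : ℕ} (hp : p.Prime) (hp3 : p ≠ 3) {h k : ℤ} (hh : ¬ (p : ℤ) ∣ h) (hk : ¬ (p : ℤ) ∣ k)

open Classical in
/-- The number of solutions of `k u ^ 3 = h` modulo `q`. -/
noncomputable def cubicSolutionCount (h k : ℤ) (q : ℕ) : ℕ :=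
  Nat.count (fun u : ℕ => (q : ℤ) ∣ k * (u : ℤ) ^ 3 - h) q

theorem dvd_cubic_iff_of_modEq {q u v : ℤ} (huv : q ∣ u - v) :
    q ∣ k * u ^ 3 - h ↔ q ∣ k * v ^ 3 - h := by
  have : q ∣ (k * u ^ 3 - h) - (k * v ^ 3 - h) := by
    rw [show (k * u ^ 3 - h) - (k * v ^ 3 - h) = (u - v) * (k * (u ^ 2 + u * v + v ^ 2)) by ring]
    exact huv.mul_right _
  exact ⟨fun H => (dvd_sub_right H).1 this, fun H => (dvd_sub_left H).1 this⟩

include hp hp3 hh hk in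
-- Hensel lifting: a root u is prime to p because h is, so the derivative 3ku² is a unit modulo p,
-- and reduction modulo p^e is a bijection on roots.
theorem cubicSolutionCount_pow_succ {e : ℕ} (he : e ≠ 0) :
    cubicSolutionCount h k (p ^ (e + 1)) = cubicSolutionCount h k (p ^ e) := by
  classical
  have hpi : Prime (p : ℤ) := Nat.prime_iff_prime_int.1 hp
  have hppos : 0 < p ^ e := pow_pos hp.pos e
  have h3 : ¬ (p : ℤ) ∣ 3 := fun H => hp3 <| (Nat.prime_dvd_prime_iff_eq hp Nat.prime_three).1
    (by exact_mod_cast H)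
  have hroot : ∀ u : ℤ, (p : ℤ) ∣ k * u ^ 3 - h → ¬ (p : ℤ) ∣ u := by
    intro u hu hpu
    exact hh ((dvd_sub_right ((dvd_pow hpu (by norm_num)).mul_left k)).1 hu)
  have hpe : (p : ℤ) ∣ (p : ℤ) ^ e := dvd_pow_self _ he
  have hpe' : (p : ℤ) ^ e ∣ (p : ℤ) ^ (e + 1) := pow_dvd_pow _ (Nat.le_succ e)
  unfold cubicSolutionCount
  rw [Nat.count_eq_card_filter_range, Nat.count_eq_card_filter_range]
  push_cast
  have hmod : ∀ u : ℕ, (p : ℤ) ^ e ∣ ((u % p ^ e : ℕ) : ℤ) - (u : ℤ) := fun u => by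
    have := Int.ModEq.dvd (Int.mod_modEq (u : ℤ) ((p : ℤ) ^ e)).symm
    exact_mod_cast this
  refine Finset.card_bij (fun u _ => u % p ^ e) ?_ ?_ ?_
  · intro u hu
    rw [Finset.mem_filter, Finset.mem_range] at hu ⊢
    exact ⟨Nat.mod_lt _ hppos, (dvd_cubic_iff_of_modEq (hmod u)).2 (hpe'.trans hu.2)⟩
  · intro u hu v hv huv
    rw [Finset.mem_filter, Finset.mem_range] at hu hv
    have h1 : (p : ℤ) ^ e ∣ (u : ℤ) - v := by
      have := Nat.modEq_iff_dvd.1 (show v ≡ u [MOD p ^ e] from huv.symm)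
      exact_mod_cast this
    have hpuv := hpe.trans h1
    have hpu := hroot u ((hpe.trans hpe').trans hu.2)
    have h2 : (p : ℤ) ^ (e + 1) ∣ ((u : ℤ) - v) * (k * ((u : ℤ) ^ 2 + u * v + v ^ 2)) := by
      have := dvd_sub hu.2 hv.2
      rwa [show k * (u : ℤ) ^ 3 - h - (k * (v : ℤ) ^ 3 - h) =
        ((u : ℤ) - v) * (k * ((u : ℤ) ^ 2 + u * v + v ^ 2)) by ring] at this
    have h4 : ¬ (p : ℤ) ∣ k * ((u : ℤ) ^ 2 + u * v + v ^ 2) := by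
      intro H
      rcases hpi.dvd_or_dvd H with H | H
      · exact hk H
      -- Modulo p the cofactor of u - v is 3u², since u ≡ v.
      · rw [show (u : ℤ) ^ 2 + u * v + v ^ 2 = 3 * (u : ℤ) ^ 2 - (u - v) * (2 * u + v) by ring,
          dvd_sub_left (hpuv.mul_right _)] at H
        rcases hpi.dvd_or_dvd H with H | H
        · exact h3 H
        · exact hpu (hpi.dvd_of_dvd_pow H)
    have h5 : IsCoprime ((p : ℤ) ^ (e + 1)) (k * ((u : ℤ) ^ 2 + u * v + v ^ 2)) :=
      ((Prime.coprime_iff_not_dvd hpi).2 h4).pow_left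
    have h6 : ((p ^ (e + 1) : ℕ) : ℤ) ∣ (u : ℤ) - v := by
      push_cast
      exact h5.dvd_of_dvd_mul_right h2
    exact (Nat.ModEq.eq_of_lt_of_lt (Nat.modEq_iff_dvd.2 h6) hv.1 hu.1).symm
  · intro u hu
    rw [Finset.mem_filter, Finset.mem_range] at hu
    obtain ⟨w, hw⟩ := hu.2
    have hpu := hroot u (hpe.trans hu.2)
    have h4 : ¬ (p : ℤ) ∣ 3 * k * u ^ 2 := by
      intro H
      rcases hpi.dvd_or_dvd H with H | H
      · exact (hpi.dvd_or_dvd H).elim h3 hk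
      · exact hpu (hpi.dvd_of_dvd_pow H)
    obtain ⟨x, y, hxy⟩ := (Prime.coprime_iff_not_dvd hpi).2 h4
    have hpos : (0 : ℤ) < (p : ℤ) ^ (e + 1) := pow_pos (by exact_mod_cast hp.pos) _
    -- Newton step: p^e w is the value at u, and y inverts the derivative modulo p.
    set z : ℤ := u + (p : ℤ) ^ e * (-w * y) with hz
    obtain ⟨v, hv⟩ := Int.eq_ofNat_of_zero_le (Int.emod_nonneg z hpos.ne')
    have hvz : (p : ℤ) ^ (e + 1) ∣ (v : ℤ) - z := by
      rw [← hv]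
      exact Int.ModEq.dvd (Int.mod_modEq z _).symm
    have hvu : (p : ℤ) ^ e ∣ (v : ℤ) - u := by
      have : (v : ℤ) - u = (v - z) + (p : ℤ) ^ e * (-w * y) := by rw [hz]; ring
      rw [this]
      exact dvd_add (hpe'.trans hvz) (Dvd.intro _ rfl)
    refine ⟨v, ?_, ?_⟩
    · rw [Finset.mem_filter, Finset.mem_range]
      constructor
      · have := Int.emod_lt_of_pos z hpos
        rw [hv] at this
        exact_mod_cast this
      · rw [dvd_cubic_iff_of_modEq hvz]
        obtain ⟨e', rfl⟩ := Nat.exists_eq_add_one_of_ne_zero he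
        refine ⟨w * x + 3 * k * u * (w * y) ^ 2 * p ^ e' -
          k * (p : ℤ) ^ e' * (p : ℤ) ^ (e' + 1) * (w * y) ^ 3, ?_⟩
        have hx : x * p = 1 - y * (3 * k * u ^ 2) := by linarith
        rw [hz]
        have : k * (u + (p : ℤ) ^ (e' + 1) * (-w * y)) ^ 3 - h =
          (k * (u : ℤ) ^ 3 - h) - p ^ (e' + 1) * w * (y * (3 * k * u ^ 2)) +
          3 * k * u * (p ^ (e' + 1)) ^ 2 * (w * y) ^ 2 - k * (p ^ (e' + 1)) ^ 3 * (w * y) ^ 3 := by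
          ring
        rw [this, hw, show y * (3 * k * (u : ℤ) ^ 2) = 1 - x * p by linarith]
        ring
    · have h6 : ((p ^ e : ℕ) : ℤ) ∣ (u : ℤ) - v := by
        push_cast
        exact (dvd_sub_comm).1 hvu
      have := Nat.modEq_iff_dvd.2 h6
      rw [Nat.ModEq, Nat.mod_eq_of_lt hu.1] at this
      exact this

include hp hk in
-- The substitution x = ku works, as (ku)³ - hk² = k²(ku³ - h).
theorem cubicSolutionCount_prime :
    cubicSolutionCount h k p = cubeRootCount p (h * k ^ 2) := by
  classical
  have : Fact p.Prime := ⟨hp⟩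
  have hk0 : (k : ZMod p) ≠ 0 := fun H => hk ((ZMod.intCast_zmod_eq_zero_iff_dvd k p).1 H)
  unfold cubicSolutionCount cubeRootCount
  rw [Nat.count_eq_card_filter_range, ← Set.ncard_coe_finset]
  refine Set.ncard_congr (fun u _ => (k : ZMod p) * (u : ZMod p)) ?_ ?_ ?_
  · intro u hu
    rw [Finset.mem_coe, Finset.mem_filter] at hu
    have h1 := (ZMod.intCast_zmod_eq_zero_iff_dvd _ p).2 hu.2
    push_cast at h1
    rw [Set.mem_ofPred_eq]
    push_cast
    linear_combination (k : ZMod p) ^ 2 * h1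
  · intro u v hu hv huv
    rw [Finset.mem_coe, Finset.mem_filter, Finset.mem_range] at hu hv
    have := mul_left_cancel₀ hk0 huv
    exact Nat.ModEq.eq_of_lt_of_lt ((ZMod.natCast_eq_natCast_iff _ _ _).1 this) hu.1 hv.1
  · intro x hx
    rw [Set.mem_ofPred_eq] at hx
    refine ⟨((k : ZMod p)⁻¹ * x).val, ?_, ?_⟩
    · rw [Finset.mem_coe, Finset.mem_filter, Finset.mem_range]
      refine ⟨ZMod.val_lt _, (ZMod.intCast_zmod_eq_zero_iff_dvd _ p).1 ?_⟩
      push_cast at hx ⊢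
      rw [ZMod.natCast_val, ZMod.cast_id', id_eq]
      field_simp
      linear_combination hx
    · rw [ZMod.natCast_val, ZMod.cast_id', id_eq, mul_inv_cancel_left₀ hk0]

include hp hp3 hh hk in
theorem cubicSolutionCount_pow {e : ℕ} (he : e ≠ 0) :
    cubicSolutionCount h k (p ^ e) = cubeRootCount p (h * k ^ 2) := by
  induction e with
  | zero => exact absurd rfl he
  | succ e ih =>
    rcases eq_or_ne e 0 with rfl | he'
    · rw [zero_add, pow_one, cubicSolutionCount_prime hp hk]
    · rw [cubicSolutionCount_pow_succ hp hp3 hh hk he', ih he']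

open Classical in
include hp hp3 hh hk in
-- With e = i - 2j and b = p^j u, the variable u runs over p^j full periods of length p^e.
theorem card_filter_cubicClosed_of_gt {i j : ℕ} (hij : 2 * j < i) :
    ((Finset.range (p ^ i)).filter fun b : ℕ =>
      CubicClosed h k ((p : ℤ) ^ i) b ((p : ℤ) ^ j)).card =
        p ^ j * cubeRootCount p (h * k ^ 2) := by
  have hpi : Prime (p : ℤ) := Nat.prime_iff_prime_int.1 hp
  obtain ⟨e, rfl⟩ := Nat.exists_eq_add_of_le hij.le
  have he : e ≠ 0 := by omega
  have : (Finset.range (p ^ (2 * j + e))).filter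
      (fun b : ℕ => CubicClosed h k ((p : ℤ) ^ (2 * j + e)) b ((p : ℤ) ^ j)) =
      ((Finset.range (p ^ e * p ^ j)).filter
        fun u : ℕ => ((p ^ e : ℕ) : ℤ) ∣ k * (u : ℤ) ^ 3 - h).image (p ^ j * ·) := by
    ext b
    simp only [Finset.mem_filter, Finset.mem_range, Finset.mem_image]
    rw [cubicClosed_iff_of_gt hpi hk hij, Nat.add_sub_cancel_left,
      show p ^ (2 * j + e) = p ^ j * (p ^ e * p ^ j) by ring]
    constructor
    · rintro ⟨h1, u, h2, h3⟩
      obtain ⟨v, rfl⟩ : p ^ j ∣ b := by exact_mod_cast Dvd.intro _ h2.symm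
      push_cast at h2
      have := mul_left_cancel₀ (pow_ne_zero j hpi.ne_zero) h2
      subst this
      exact ⟨v, ⟨lt_of_mul_lt_mul_left h1 (Nat.zero_le _), by push_cast; exact h3⟩, rfl⟩
    · rintro ⟨u, ⟨hu, hd⟩, rfl⟩
      exact ⟨Nat.mul_lt_mul_of_pos_left hu (pow_pos hp.pos j), u, by push_cast; rfl,
        by exact_mod_cast hd⟩
  rw [this, Finset.card_image_of_injective _
    (fun x y hxy => Nat.eq_of_mul_eq_mul_left (pow_pos hp.pos j) hxy),
    ← Nat.count_eq_card_filter_range, Nat.count_mul_of_periodic,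
    ← cubicSolutionCount_pow hp hp3 hh hk he]
  · rfl
  · intro u
    exact dvd_cubic_iff_of_modEq (by simp)

end Hensel

/-! ### Summation over the diagonal exponents -/

theorem sum_range_ite_shift {n s e : ℕ} (he : e ≤ n + 1) (f : ℕ → ℕ) :
    ∑ i ∈ Finset.range (n + 1), (if s ≤ i ∧ i < e then f (i - s) else 0) =
      ∑ t ∈ Finset.range (e - s), f t := by
  rw [← Finset.sum_filter]
  have : (Finset.range (n + 1)).filter (fun i => s ≤ i ∧ i < e) = Finset.Ico s e := by
    ext i
    simp only [Finset.mem_filter, Finset.mem_range, Finset.mem_Ico]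
    omega
  rw [this, Finset.sum_Ico_eq_sum_range]
  simp

open Classical in
/-- The number of triples `(p ^ i, b, p ^ (n - i))` with `b < p ^ i` satisfying `CubicClosed`. -/
noncomputable def cubicClosedCount (h k : ℤ) (p n : ℕ) : ℕ :=
  ∑ i ∈ Finset.range (n + 1), ((Finset.range (p ^ i)).filter fun b : ℕ =>
      CubicClosed h k ((p : ℤ) ^ i) b ((p : ℤ) ^ (n - i))).card

section Count

variable {p : ℕ} (hp : p.Prime) {h' k' : ℤ} (hh' : ¬ (p : ℤ) ∣ h') (hk' : ¬ (p : ℤ) ∣ k')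
  {κ η : ℕ}

open Classical in
include hp hk' in
-- For j = n - i, the condition j ≤ 2i + κ says exactly that the required power of p does not exceed
-- p^i.
theorem card_filter_cubicClosed_of_le (hκ : κ ≤ 1) {n i : ℕ} (hi : i ≤ n)
    (hij : i ≤ 2 * (n - i) + η) :
    ((Finset.range (p ^ i)).filter fun b : ℕ => CubicClosed ((p : ℤ) ^ η * h') ((p : ℤ) ^ κ * k')
      ((p : ℤ) ^ i) b ((p : ℤ) ^ (n - i))).card =
        if (n - κ + 2) / 3 ≤ i then p ^ (i - (n - κ + 2) / 3) else 0 := by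
  simp_rw [cubicClosed_iff_of_le (Nat.prime_iff_prime_int.1 hp) hk' hκ hij, Nat.add_sub_cancel' hi]
  split_ifs with hs
  · rw [← card_filter_pow_dvd hp.pos hs]
    congr 1
    ext b
    simp only [Finset.mem_filter, and_congr_right_iff, and_iff_right_iff_imp]
    intros
    omega
  · rw [Finset.card_eq_zero, Finset.filter_eq_empty_iff]
    intro b _ H
    omega

include hp hh' hk' in
theorem cubicClosedCount_of_ramified (hκη : κ + η = 1) (n : ℕ) :
    cubicClosedCount ((p : ℤ) ^ η * h') ((p : ℤ) ^ κ * k') p n =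
      ∑ t ∈ Finset.range (n / 3 + 1), p ^ t := by
  classical
  have hpi : Prime (p : ℤ) := Nat.prime_iff_prime_int.1 hp
  have key := sum_range_ite_shift (n := n) (s := (n - κ + 2) / 3)
    (e := min (n + 1) ((2 * n + η) / 3 + 1))
    (min_le_left _ _) (fun t => p ^ t)
  -- The contributing i run from ⌈(n - κ)/3⌉ to ⌊(2n + η)/3⌋, which is ⌊n/3⌋ + 1 values in either
  -- ramified case.
  rw [show min (n + 1) ((2 * n + η) / 3 + 1) - (n - κ + 2) / 3 = n / 3 + 1 by
    obtain ⟨q, hq⟩ : ∃ q, n = 3 * q ∨ n = 3 * q + 1 ∨ n = 3 * q + 2 := ⟨n / 3, by omega⟩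
    rcases (show κ = 0 ∧ η = 1 ∨ κ = 1 ∧ η = 0 by omega) with ⟨rfl, rfl⟩ | ⟨rfl, rfl⟩ <;>
      rcases hq with rfl | rfl | rfl <;> omega] at key
  rw [← key]
  refine Finset.sum_congr rfl fun i hi => ?_
  rw [Finset.mem_range] at hi
  rcases le_or_gt i (2 * (n - i) + η) with hij | hij
  · rw [card_filter_cubicClosed_of_le hp hk' (by omega) (by omega) hij]
    refine if_congr ?_ rfl rfl
    omega
  · rw [if_neg (by omega), Finset.card_eq_zero, Finset.filter_eq_empty_iff]
    exact fun b _ => not_cubicClosed_of_gt hpi hh' hk' hκη hij b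

include hp hh' hk' in
theorem cubicClosedCount_of_unramified (hp3 : p ≠ 3) (n : ℕ) :
    cubicClosedCount h' k' p n = ∑ t ∈ Finset.range (2 * n / 3 + 1 - (n + 2) / 3), p ^ t +
      (∑ t ∈ Finset.range ((n + 2) / 3), p ^ t) * cubeRootCount p (h' * k' ^ 2) := by
  classical
  have key := sum_range_ite_shift (n := n) (s := (n + 2) / 3) (e := 2 * n / 3 + 1)
    (by omega) (fun t => p ^ t)
  have key' := sum_range_ite_shift (n := n) (s := 0) (e := (n + 2) / 3)
    (by omega) (fun t => p ^ t * cubeRootCount p (h' * k' ^ 2))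
  -- The range i > 2n/3 contributes p^(n - i) r_p, so the sum is reindexed by n - i, which is less
  -- than ⌈n/3⌉.
  rw [← Finset.sum_range_reflect] at key'
  rw [Nat.sub_zero] at key'
  rw [Finset.sum_mul, ← key, ← key', ← Finset.sum_add_distrib]
  refine Finset.sum_congr rfl fun i hi => ?_
  rw [Finset.mem_range] at hi
  rw [show n + 1 - 1 - i - 0 = n - i by omega]
  rcases le_or_gt i (2 * (n - i)) with hij | hij
  · have := card_filter_cubicClosed_of_le (η := 0) (h' := h') hp hk' zero_le_one
      (by omega : i ≤ n) hij
    rw [pow_zero, one_mul, one_mul, Nat.sub_zero] at this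
    rw [this, if_neg (show ¬ (0 ≤ n + 1 - 1 - i ∧ n + 1 - 1 - i < (n + 2) / 3) by omega), add_zero]
    refine if_congr ?_ rfl rfl
    omega
  · rw [if_neg (by omega), if_pos (by omega), zero_add,
      card_filter_cubicClosed_of_gt hp hp3 hh' hk' hij]

end Count

/-! ### The closed formula -/

theorem Rat.floor_natCast_div_three (n : ℕ) : ⌊(n : ℚ) / 3⌋ = ((n / 3 : ℕ) : ℤ) := by
  exact_mod_cast Rat.floor_natCast_div_natCast n 3

theorem Rat.ceil_natCast_div_three (n : ℕ) : ⌈(n : ℚ) / 3⌉ = (((n + 2) / 3 : ℕ) : ℤ) := by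
  have := Rat.ceil_natCast_div_natCast n 3
  push_cast at this ⊢
  rw [this]
  omega

theorem cubicClosedCount_eq {p : ℕ} (hp : p.Prime) (hp3 : p ≠ 3) {h k : ℤ} (hh : Squarefree h)
    (hk : Squarefree k) (hhk : IsCoprime h k) (n : ℕ) :
    (cubicClosedCount h k p n : ℚ) = pureCubicOrderCount (h * k ^ 2) p n := by
  have hpi : Prime (p : ℤ) := Nat.prime_iff_prime_int.1 hp
  have hp1 : (p : ℚ) ≠ 1 := by exact_mod_cast hp.ne_one
  have hdiv : ∀ {x : ℤ}, Squarefree x → (p : ℤ) ∣ x → ∃ y, ¬ (p : ℤ) ∣ y ∧ x = (p : ℤ) ^ 1 * y := by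
    rintro x hx ⟨y, rfl⟩
    refine ⟨y, fun ⟨z, hz⟩ => hpi.not_isUnit (hx p ⟨z, by rw [hz]; ring⟩), by rw [pow_one]⟩
  have hram : (p : ℤ) ∣ h * k ^ 2 → (cubicClosedCount h k p n : ℚ) =
      ((∑ t ∈ Finset.range (n / 3 + 1), p ^ t : ℕ) : ℚ) := by
    intro H
    rcases hpi.dvd_or_dvd H with H | H
    · have hk' : ¬ (p : ℤ) ∣ k := fun H' => hpi.not_isUnit (hhk.isUnit_of_dvd' H H')
      obtain ⟨y, hy, rfl⟩ := hdiv hh H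
      have := cubicClosedCount_of_ramified hp hy hk' (κ := 0) (η := 1) rfl n
      rw [pow_zero, one_mul] at this
      rw [this]
    · replace H := hpi.dvd_of_dvd_pow H
      have hh' : ¬ (p : ℤ) ∣ h := fun H' => hpi.not_isUnit (hhk.isUnit_of_dvd' H' H)
      obtain ⟨y, hy, rfl⟩ := hdiv hk H
      have := cubicClosedCount_of_ramified hp hh' hy (κ := 1) (η := 0) rfl n
      rw [pow_zero, one_mul] at this
      rw [this]
  unfold pureCubicOrderCount
  split_ifs with H
  · rw [hram H, Rat.floor_natCast_div_three]
    push_cast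
    rw [geom_sum_eq hp1]
    norm_cast
  · have hh' : ¬ (p : ℤ) ∣ h := fun H' => H (H'.mul_right _)
    have hk' : ¬ (p : ℤ) ∣ k := fun H' => H ((dvd_pow H' two_ne_zero).mul_left _)
    rw [cubicClosedCount_of_unramified hp hh' hk' hp3]
    have h1 : ⌊(2 * n : ℚ) / 3⌋ = ((2 * n / 3 : ℕ) : ℤ) := by
      exact_mod_cast Rat.floor_natCast_div_three (2 * n)
    -- The exponent is never negative (it is 0 for n = 1), so natural subtraction does not truncate.
    have h2 : ((2 * n / 3 : ℕ) : ℤ) - (((n + 2) / 3 : ℕ) : ℤ) + 1 =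
        ((2 * n / 3 + 1 - (n + 2) / 3 : ℕ) : ℤ) := by omega
    rw [h1, Rat.ceil_natCast_div_three, h2, zpow_natCast, zpow_natCast, ← geom_sum_eq hp1,
      ← geom_sum_eq hp1]
    push_cast
    rfl

/-! ### Divisibility of the norm form -/

section Arithmetic

variable {q h k a b c : ℤ}

/-- Since q divides h exactly once, the three pure terms have valuations 0, 1, 2 modulo 3. Dividing
out q successively yields a, then b, then c. -/
theorem Prime.dvd_of_pow_three_dvd_norm_form_of_dvd (hq : Prime q) (hh : Squarefree h)
    (hqh : q ∣ h) (hqk : ¬ q ∣ k)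
    (hN : q ^ 3 ∣ a ^ 3 + h * k ^ 2 * b ^ 3 + h ^ 2 * k * c ^ 3 - 3 * h * k * a * b * c) :
    q ∣ a ∧ q ∣ b ∧ q ∣ c := by
  obtain ⟨h', rfl⟩ := hqh
  have hh' : ¬ q ∣ h' := fun ⟨z, hz⟩ => hq.not_isUnit (hh q ⟨z, by rw [hz]; ring⟩)
  obtain ⟨w, hw⟩ := hN
  have ha : q ∣ a := hq.dvd_of_dvd_pow (n := 3)
    ⟨q ^ 2 * w - h' * k ^ 2 * b ^ 3 - q * h' ^ 2 * k * c ^ 3 + 3 * h' * k * a * b * c, by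
      linear_combination hw⟩
  obtain ⟨a, rfl⟩ := ha
  have hb : q ∣ b := by
    have : q ∣ h' * k ^ 2 * b ^ 3 :=
      ⟨q * w - q * a ^ 3 - h' ^ 2 * k * c ^ 3 + 3 * h' * k * a * b * c, by
        apply mul_left_cancel₀ hq.ne_zero; linear_combination hw⟩
    rcases hq.dvd_or_dvd this with H | H
    · rcases hq.dvd_or_dvd H with H | H
      · exact absurd H hh'
      · exact absurd (hq.dvd_of_dvd_pow H) hqk
    · exact hq.dvd_of_dvd_pow H
  obtain ⟨b, rfl⟩ := hb
  refine ⟨dvd_mul_right _ _, dvd_mul_right _ _, ?_⟩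
  have : q ∣ h' ^ 2 * k * c ^ 3 :=
    ⟨w - a ^ 3 - q * h' * k ^ 2 * b ^ 3 + 3 * h' * k * a * b * c, by
      apply mul_left_cancel₀ (pow_ne_zero 2 hq.ne_zero); linear_combination hw⟩
  rcases hq.dvd_or_dvd this with H | H
  · rcases hq.dvd_or_dvd H with H | H
    · exact absurd (hq.dvd_of_dvd_pow H) hh'
    · exact absurd H hqk
  · exact hq.dvd_of_dvd_pow H

/-- The minimal polynomial of θ - m has constant term m³ - m = 3t with 3 ∤ t, so it is Eisenstein at
3, and the argument for q ∣ h applies in powers of θ - m. -/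
theorem Int.three_dvd_of_norm_form (hhk : ¬ (3 : ℤ) ∣ h * k)
    (hm9 : ¬ (h * k ^ 2) ^ 2 ≡ 1 [ZMOD 9])
    (hN : (3 : ℤ) ^ 3 ∣ a ^ 3 + h * k ^ 2 * b ^ 3 + h ^ 2 * k * c ^ 3 - 3 * h * k * a * b * c) :
    3 ∣ a ∧ 3 ∣ b ∧ 3 ∣ c := by
  have h3 : Prime (3 : ℤ) := Int.prime_three
  have hk : ¬ (3 : ℤ) ∣ k := fun H => hhk (H.mul_left _)
  have hm : ¬ (3 : ℤ) ∣ h * k ^ 2 := by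
    intro H
    rw [sq, ← mul_assoc] at H
    exact (h3.dvd_or_dvd H).elim hhk hk
  obtain ⟨m, hmdef⟩ : ∃ m, m = h * k ^ 2 := ⟨_, rfl⟩
  rw [← hmdef] at hm hm9
  obtain ⟨s, hs⟩ : (3 : ℤ) ∣ m ^ 2 - 1 := by
    have : m % 3 = 1 ∨ m % 3 = 2 := by omega
    apply Int.dvd_of_emod_eq_zero
    rcases this with H | H <;> simp [pow_two, Int.sub_emod, Int.mul_emod, H]
  have hs3 : ¬ (3 : ℤ) ∣ s := by
    rintro ⟨v, rfl⟩
    exact hm9 (Int.modEq_iff_dvd.2 ⟨-v, by linear_combination -hs⟩)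
  obtain ⟨t, ht⟩ : ∃ t, t = m * s := ⟨_, rfl⟩
  have ht3 : ¬ (3 : ℤ) ∣ t := by
    rw [ht]
    exact fun H => (h3.dvd_or_dvd H).elim hm hs3
  have hmt : m ^ 3 - m = 3 * t := by rw [ht]; linear_combination m * hs
  obtain ⟨w, hw⟩ := hN
  -- A, B, c are the coordinates of k(a + bθ + cθ²/k) in 1, θ - m, (θ - m)²; `key` is its norm in
  -- these coordinates.
  obtain ⟨A, hA⟩ : ∃ A, A = k * a + k * b * m + c * m ^ 2 := ⟨_, rfl⟩
  obtain ⟨B, hB⟩ : ∃ B, B = k * b + 2 * m * c := ⟨_, rfl⟩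
  have key : A ^ 3 - 3 * m * A ^ 2 * B + 3 * m ^ 2 * A ^ 2 * c + 3 * m ^ 2 * A * B ^ 2
      + (-9 * m ^ 3 + 9 * t) * A * B * c + (9 * m ^ 4 - 18 * m * t) * A * c ^ 2 - 3 * t * B ^ 3
      + 9 * m * t * B ^ 2 * c - 9 * m ^ 2 * t * B * c ^ 2 + 9 * t ^ 2 * c ^ 3 =
      27 * (k ^ 3 * w) := by
    have : (9 : ℤ) * t ^ 2 = (m ^ 3 - m) ^ 2 := by rw [hmt]; ring
    rw [this, show -9 * m ^ 3 + 9 * t = -9 * m ^ 3 + 3 * (m ^ 3 - m) by rw [hmt]; ring,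
      show 18 * m * t = 6 * m * (m ^ 3 - m) by rw [hmt]; ring,
      show 9 * m * t = 3 * m * (m ^ 3 - m) by rw [hmt]; ring,
      show 9 * m ^ 2 * t = 3 * m ^ 2 * (m ^ 3 - m) by rw [hmt]; ring, ← hmt, hA, hB, hmdef]
    linear_combination k ^ 3 * hw
  have h3A : (3 : ℤ) ∣ A := h3.dvd_of_dvd_pow (n := 3) (by
    rw [show A ^ 3 = 3 * (9 * (k ^ 3 * w) + m * A ^ 2 * B - m ^ 2 * A ^ 2 * c - m ^ 2 * A * B ^ 2
      - (-3 * m ^ 3 + 3 * t) * A * B * c - (3 * m ^ 4 - 6 * m * t) * A * c ^ 2 + t * B ^ 3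
      - 3 * m * t * B ^ 2 * c + 3 * m ^ 2 * t * B * c ^ 2 - 3 * t ^ 2 * c ^ 3) by
        linear_combination key]
    exact dvd_mul_right _ _)
  obtain ⟨A, rfl⟩ := h3A
  have h3B : (3 : ℤ) ∣ B := by
    have : (3 : ℤ) ∣ t * B ^ 3 := ⟨3 * A ^ 3 - 3 * m * A ^ 2 * B + 3 * m ^ 2 * A ^ 2 * c
      + m ^ 2 * A * B ^ 2
      + (-3 * m ^ 3 + 3 * t) * A * B * c + (3 * m ^ 4 - 6 * m * t) * A * c ^ 2
      + m * t * B ^ 2 * c - m ^ 2 * t * B * c ^ 2 + t ^ 2 * c ^ 3 - 3 * (k ^ 3 * w), by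
        apply mul_left_cancel₀ (show (3 : ℤ) ≠ 0 by norm_num); linear_combination -key⟩
    exact (h3.dvd_or_dvd this).elim (fun H => absurd H ht3) h3.dvd_of_dvd_pow
  obtain ⟨B, rfl⟩ := h3B
  have h3c : (3 : ℤ) ∣ c := by
    have : (3 : ℤ) ∣ t ^ 2 * c ^ 3 := ⟨k ^ 3 * w - A ^ 3 + 3 * m * A ^ 2 * B - m ^ 2 * A ^ 2 * c
      - 3 * m ^ 2 * A * B ^ 2 - (-3 * m ^ 3 + 3 * t) * A * B * c - (m ^ 4 - 2 * m * t) * A * c ^ 2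
      + 3 * t * B ^ 3 - 3 * m * t * B ^ 2 * c + m ^ 2 * t * B * c ^ 2, by
        apply mul_left_cancel₀ (show (9 : ℤ) ≠ 0 by norm_num); linear_combination key⟩
    exact (h3.dvd_or_dvd this).elim (fun H => absurd (h3.dvd_of_dvd_pow H) ht3) h3.dvd_of_dvd_pow
  obtain ⟨c, rfl⟩ := h3c
  have h3b : (3 : ℤ) ∣ b := by
    have : (3 : ℤ) ∣ k * b := ⟨B - 2 * m * c, by linear_combination -hB⟩
    exact (h3.dvd_or_dvd this).resolve_left hk
  obtain ⟨b, rfl⟩ := h3b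
  refine ⟨?_, dvd_mul_right _ _, dvd_mul_right _ _⟩
  have : (3 : ℤ) ∣ k * a := ⟨A - k * b * m - c * m ^ 2, by linear_combination -hA⟩
  exact (h3.dvd_or_dvd this).resolve_left hk

theorem Prime.dvd_of_norm_form (hq : Prime q) (hh : Squarefree h) (hk : Squarefree k)
    (hhk : IsCoprime h k) (hm9 : ¬ (h * k ^ 2) ^ 2 ≡ 1 [ZMOD 9])
    (hN : q ^ 3 ∣ a ^ 3 + h * k ^ 2 * b ^ 3 + h ^ 2 * k * c ^ 3 - 3 * h * k * a * b * c)
    (ha : q ∣ 3 * a) (hb : q ∣ 3 * h * k * b) (hc : q ∣ 3 * h * k * c) :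
    q ∣ a ∧ q ∣ b ∧ q ∣ c := by
  by_cases hqh : q ∣ h
  · exact hq.dvd_of_pow_three_dvd_norm_form_of_dvd hh hqh
      (fun H => hq.not_isUnit (hhk.isUnit_of_dvd' hqh H)) hN
  by_cases hqk : q ∣ k
  -- The norm form is invariant under exchanging (h, b) with (k, c).
  · have := hq.dvd_of_pow_three_dvd_norm_form_of_dvd (a := a) (b := c) (c := b) hk hqk hqh
      (by convert hN using 1; ring)
    exact ⟨this.1, this.2.2, this.2.1⟩
  have hqhk : ¬ q ∣ h * k := fun H => (hq.dvd_or_dvd H).elim hqh hqk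
  by_cases hq3 : q ∣ 3
  · have hassoc : Associated q 3 := (hq.dvd_prime_iff_associated Int.prime_three).1 hq3
    simp only [hassoc.dvd_iff_dvd_left] at hqhk ⊢
    exact Int.three_dvd_of_norm_form hqhk hm9 ((hassoc.pow_pow).dvd_iff_dvd_left.1 hN)
  · rw [mul_assoc 3] at hb hc
    refine ⟨(hq.dvd_or_dvd ha).resolve_left hq3, ?_, ?_⟩
    · rcases hq.dvd_or_dvd hb with H | H
      · exact absurd ((hq.dvd_or_dvd H).resolve_left hq3) hqhk
      · exact H
    · rcases hq.dvd_or_dvd hc with H | H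
      · exact absurd ((hq.dvd_or_dvd H).resolve_left hq3) hqhk
      · exact H

end Arithmetic

/-! ### The integral basis -/

section Field

variable {K : Type*} [Field K] [NumberField K]

/-- A rational cube root of m would be an integer, hence a unit by cube-freeness, giving m² = 1. -/
theorem natDegree_minpoly_of_pow_three_eq {m : ℤ} (hcube : ∀ d : ℤ, d ^ 3 ∣ m → IsUnit d)
    (hm9 : ¬ m ^ 2 ≡ 1 [ZMOD 9]) {θ : K} (hθ : θ ^ 3 = (m : K)) :
    (minpoly ℚ θ).natDegree = 3 := by
  have hirr : Irreducible (Polynomial.X ^ 3 - Polynomial.C (m : ℚ)) := by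
    refine X_pow_sub_C_irreducible_of_prime Nat.prime_three fun r hr => ?_
    have hint : IsIntegral ℤ r := by
      refine IsIntegral.of_pow (n := 3) (by norm_num) ?_
      rw [hr]
      exact isIntegral_algebraMap (R := ℤ) (A := ℚ) (x := m)
    obtain ⟨s, rfl⟩ := IsIntegrallyClosed.isIntegral_iff.1 hint
    have hs : s ^ 3 = m := by
      have : ((s : ℤ) : ℚ) ^ 3 = m := hr
      exact_mod_cast this
    apply hm9
    rcases Int.isUnit_iff.1 (hcube s hs.dvd) with rfl | rfl <;> rw [← hs] <;> decide
  rw [← minpoly.eq_of_irreducible_of_monic hirr (by simp [hθ])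
    (Polynomial.monic_X_pow_sub_C _ (by norm_num)), Polynomial.natDegree_X_pow_sub_C]

theorem linearIndependent_one_self_sq_div {θ : K} (hdeg : (minpoly ℚ θ).natDegree = 3) {k : ℤ}
    (hk : k ≠ 0) : LinearIndependent ℚ ![1, θ, θ ^ 2 / (k : K)] := by
  have h1 := (linearIndependent_pow (K := ℚ) θ).comp (Fin.cast hdeg.symm) (Fin.cast_injective _)
  have hkQ : (k : ℚ) ≠ 0 := by exact_mod_cast hk
  have hkK : (k : K) ≠ 0 := by exact_mod_cast hk
  rw [Fintype.linearIndependent_iff] at h1 ⊢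
  intro g hg
  have h2 := h1 ![g 0, g 1, g 2 / k] (by
    rw [← hg]
    simp [Fin.sum_univ_three, Algebra.smul_def]
    field_simp)
  intro i
  fin_cases i
  · simpa using h2 0
  · simpa using h2 1
  · simpa [hkQ] using h2 2

variable {h k : ℤ} {ω ψ : K} (h11 : ω ^ 2 = k * ψ) (h12 : ω * ψ = h * k) (h22 : ψ ^ 2 = h * ω)
  (B : Module.Basis (Fin 3) ℚ K) (hB0 : B 0 = 1) (hB1 : B 1 = ω) (hB2 : B 2 = ψ)

include h11 h12 h22 hB0 hB1 hB2 in
theorem leftMulMatrix_pureCubic (a b c : ℚ) :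
    Algebra.leftMulMatrix B (a + b * ω + c * ψ) =
      !![a, h * k * c, h * k * b; b, a, h * c; c, k * b, a] := by
  have hrepr : ∀ x y z : ℚ, ∀ i, B.repr (x + y * ω + z * ψ) i = ![x, y, z] i := by
    intro x y z i
    have : (x : K) + y * ω + z * ψ = x • B 0 + y • B 1 + z • B 2 := by
      simp [hB0, hB1, hB2, Algebra.smul_def]
    rw [this]
    fin_cases i <;> simp
  ext i j
  rw [Algebra.leftMulMatrix_eq_repr_mul]
  fin_cases j
  · have : ((a : K) + b * ω + c * ψ) * B 0 = a + b * ω + c * ψ := by rw [hB0, mul_one]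
    rw [show ((fun i => i) (⟨0, by decide⟩ : Fin 3)) = 0 from rfl, this, hrepr]
    fin_cases i <;> rfl
  · have : ((a : K) + b * ω + c * ψ) * B 1 =
        (h * k * c : ℚ) + (a : ℚ) * ω + (k * b : ℚ) * ψ := by
      rw [hB1]; push_cast; linear_combination (b : K) * h11 + (c : K) * h12
    rw [show ((fun i => i) (⟨1, by decide⟩ : Fin 3)) = 1 from rfl, this, hrepr]
    fin_cases i <;> rfl
  · have : ((a : K) + b * ω + c * ψ) * B 2 =
        (h * k * b : ℚ) + (h * c : ℚ) * ω + (a : ℚ) * ψ := by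
      rw [hB2]; push_cast; linear_combination (b : K) * h12 + (c : K) * h22
    rw [show ((fun i => i) (⟨2, by decide⟩ : Fin 3)) = 2 from rfl, this, hrepr]
    fin_cases i <;> rfl

include h11 h12 h22 hB0 hB1 hB2 in
theorem norm_pureCubic (a b c : ℚ) :
    Algebra.norm ℚ ((a : K) + b * ω + c * ψ) =
      a ^ 3 + h * k ^ 2 * b ^ 3 + h ^ 2 * k * c ^ 3 - 3 * h * k * a * b * c := by
  rw [Algebra.norm_eq_matrix_det B, leftMulMatrix_pureCubic h11 h12 h22 B hB0 hB1 hB2,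
    Matrix.det_fin_three]
  simp
  ring

include h11 h12 h22 hB0 hB1 hB2 in
theorem trace_pureCubic (a b c : ℚ) :
    Algebra.trace ℚ K ((a : K) + b * ω + c * ψ) = 3 * a := by
  rw [Algebra.trace_eq_matrix_trace B, leftMulMatrix_pureCubic h11 h12 h22 B hB0 hB1 hB2,
    Matrix.trace_fin_three]
  simp
  ring

omit [NumberField K] in
include h11 h12 h22 in
theorem isIntegral_pureCubic : IsIntegral ℤ ω ∧ IsIntegral ℤ ψ := by
  constructor
  · refine IsIntegral.of_pow (n := 3) (by norm_num) ?_
    rw [show ω ^ 3 = ((h * k ^ 2 : ℤ) : K) by push_cast; linear_combination ω * h11 + k * h12]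
    exact isIntegral_algebraMap (R := ℤ) (A := K) (x := h * k ^ 2)
  · refine IsIntegral.of_pow (n := 3) (by norm_num) ?_
    rw [show ψ ^ 3 = ((h ^ 2 * k : ℤ) : K) by push_cast; linear_combination ψ * h22 + h * h12]
    exact isIntegral_algebraMap (R := ℤ) (A := K) (x := h ^ 2 * k)

include h11 h12 h22 hB0 hB1 hB2 in
theorem prime_dvd_coord_of_isIntegral (hh : Squarefree h) (hk : Squarefree k)
    (hhk : IsCoprime h k) (hm9 : ¬ (h * k ^ 2) ^ 2 ≡ 1 [ZMOD 9]) {q : ℤ} (hq : Prime q) {x : K}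
    (hx : IsIntegral ℤ x) {a b c : ℤ} (hqx : (q : K) * x = a + b * ω + c * ψ) :
    q ∣ a ∧ q ∣ b ∧ q ∣ c := by
  obtain ⟨hω, hψ⟩ := isIntegral_pureCubic h11 h12 h22
  have htr : ∀ {y : K}, IsIntegral ℤ y → ∀ {a b c : ℤ}, (q : K) * y = a + b * ω + c * ψ →
      q ∣ 3 * a := by
    intro y hy a b c hqy
    obtain ⟨s, hs⟩ := IsIntegrallyClosed.isIntegral_iff.1 (Algebra.isIntegral_trace (L := ℚ) hy)
    have h1 := trace_pureCubic h11 h12 h22 B hB0 hB1 hB2 a b c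
    have h2 : Algebra.trace ℚ K ((q : K) * y) = q * s := by
      have : (q : K) * y = (q : ℚ) • y := by simp [Algebra.smul_def]
      rw [this, map_smul, smul_eq_mul, ← hs]
      rfl
    push_cast at h1
    rw [← hqy, h2] at h1
    exact ⟨s, by exact_mod_cast h1.symm⟩
  refine hq.dvd_of_norm_form hh hk hhk hm9 ?_ (htr hx hqx) ?_ ?_
  · obtain ⟨s, hs⟩ := IsIntegrallyClosed.isIntegral_iff.1 (Algebra.isIntegral_norm ℚ hx)
    have h1 := norm_pureCubic h11 h12 h22 B hB0 hB1 hB2 a b c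
    have h2 : Algebra.norm ℚ ((q : K) * x) = q ^ 3 * s := by
      have : (q : K) = algebraMap ℚ K q := by simp
      rw [map_mul, this, Algebra.norm_algebraMap, ← hs, Module.finrank_eq_card_basis B]
      simp
    push_cast at h1
    rw [← hqx, h2] at h1
    exact ⟨s, by exact_mod_cast h1.symm⟩
  -- Multiplying by ψ, and below by ω, moves b and c into the constant coordinate, which the trace
  -- sees.
  · have := htr (hx.mul hψ) (a := h * k * b) (b := h * c) (c := a) (by
      push_cast
      linear_combination ψ * hqx + b * h12 + c * h22)
    rwa [← mul_assoc, ← mul_assoc] at this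
  · have := htr (hx.mul hω) (a := h * k * c) (b := a) (c := k * b) (by
      push_cast
      linear_combination ω * hqx + b * h11 + c * h12)
    rwa [← mul_assoc, ← mul_assoc] at this

include h11 h12 h22 hB0 hB1 hB2 in
theorem exists_int_coords_of_isIntegral (hh : Squarefree h) (hk : Squarefree k)
    (hhk : IsCoprime h k) (hm9 : ¬ (h * k ^ 2) ^ 2 ≡ 1 [ZMOD 9]) {x : K} (hx : IsIntegral ℤ x) :
    ∃ a b c : ℤ, x = a + b * ω + c * ψ := by
  have key : ∀ D : ℕ, D ≠ 0 → (∃ a b c : ℤ, (D : K) * x = a + b * ω + c * ψ) →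
      ∃ a b c : ℤ, x = a + b * ω + c * ψ := by
    intro D
    induction D using induction_on_primes with
    | zero => exact fun H => absurd rfl H
    | one => simp
    | prime_mul q D hq ih =>
      rintro hD ⟨a, b, c, habc⟩
      have hqi : Prime (q : ℤ) := Nat.prime_iff_prime_int.1 hq
      have hqK : (q : K) ≠ 0 := by exact_mod_cast hq.ne_zero
      obtain ⟨⟨a', rfl⟩, ⟨b', rfl⟩, ⟨c', rfl⟩⟩ :=
        prime_dvd_coord_of_isIntegral h11 h12 h22 B hB0 hB1 hB2 hh hk hhk hm9 hqi
          (x := (D : K) * x) (by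
            simpa using (isIntegral_algebraMap (R := ℤ) (A := K) (x := (D : ℤ))).mul hx)
          (a := a) (b := b) (c := c)
          (by push_cast at habc ⊢; rw [← mul_assoc]; exact habc)
      refine ih (right_ne_zero_of_mul hD) ⟨a', b', c', mul_left_cancel₀ hqK ?_⟩
      push_cast at habc
      linear_combination habc
  obtain ⟨⟨D, hD⟩, hint⟩ := IsLocalization.exist_integer_multiples_of_finset (nonZeroDivisors ℤ)
    (Finset.univ.image (B.repr x))
  have hc : ∀ i, ∃ z : ℤ, (z : ℚ) = D * B.repr x i := by
    intro i
    obtain ⟨z, hz⟩ := hint (B.repr x i) (Finset.mem_image_of_mem _ (Finset.mem_univ _))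
    exact ⟨z, by simpa [Algebra.smul_def] using hz⟩
  choose z hz using hc
  have hDx : (D : K) * x = z 0 + z 1 * ω + z 2 * ψ := by
    have hz' : ∀ i, (z i : K) = D * (B.repr x i : ℚ) := by
      intro i
      have := congrArg (algebraMap ℚ K) (hz i)
      simpa using this
    have hsum := B.sum_repr x
    rw [Fin.sum_univ_three, hB0, hB1, hB2] at hsum
    simp only [Algebra.smul_def, eq_ratCast] at hsum
    rw [hz', hz', hz']
    nth_rewrite 1 [← hsum]
    ring
  have hD0 : D ≠ 0 := nonZeroDivisors.ne_zero hD
  obtain ⟨N, rfl | rfl⟩ := D.eq_nat_or_neg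
  · exact key N (by simpa using hD0) ⟨z 0, z 1, z 2, by simpa using hDx⟩
  · refine key N (by simpa using hD0) ⟨-z 0, -z 1, -z 2, ?_⟩
    push_cast at hDx ⊢
    linear_combination -hDx

theorem isIntegralBasis_pureCubic {m h k : ℤ} (hcube : ∀ d : ℤ, d ^ 3 ∣ m → IsUnit d)
    (hm9 : ¬ m ^ 2 ≡ 1 [ZMOD 9]) (hmhk : m = h * k ^ 2) (hh : Squarefree h) (hk : Squarefree k)
    (hhk : IsCoprime h k) {θ : K} (hθ : θ ^ 3 = (m : K)) (hK : Module.finrank ℚ K = 3) :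
    IsIntegralBasis ![1, θ, θ ^ 2 / (k : K)] := by
  have hkK : (k : K) ≠ 0 := by exact_mod_cast hk.ne_zero
  have hli := linearIndependent_one_self_sq_div
    (natDegree_minpoly_of_pow_three_eq hcube hm9 hθ) hk.ne_zero
  let B := basisOfLinearIndependentOfCardEqFinrank hli (by rw [hK]; rfl)
  have hB : ∀ i, B i = (![1, θ, θ ^ 2 / (k : K)] : Fin 3 → K) i := by simp [B]
  have h11 : θ ^ 2 = k * (θ ^ 2 / k) := by field_simp
  have hθ' : θ ^ 3 = h * k ^ 2 := by rw [hθ, hmhk]; push_cast; rfl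
  have h12 : θ * (θ ^ 2 / k) = h * k := by field_simp; linear_combination hθ'
  have h22 : (θ ^ 2 / k) ^ 2 = h * θ := by field_simp; linear_combination θ * hθ'
  obtain ⟨hω, hψ⟩ := isIntegral_pureCubic h11 h12 h22
  refine ⟨hli.restrict_scalars' ℤ, le_antisymm ?_ ?_⟩
  · rw [Submodule.span_le]
    rintro _ ⟨i, rfl⟩
    fin_cases i
    · exact isIntegral_one
    · exact hω
    · exact hψ
  · intro x hx
    obtain ⟨a, b, c, rfl⟩ := exists_int_coords_of_isIntegral h11 h12 h22 B (hB 0) (hB 1) (hB 2)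
      hh hk hhk (hmhk ▸ hm9) (show IsIntegral ℤ x from hx)
    have hmem : ∀ i, (![1, θ, θ ^ 2 / (k : K)] : Fin 3 → K) i ∈
        Submodule.span ℤ (Set.range ![1, θ, θ ^ 2 / (k : K)]) :=
      fun i => Submodule.subset_span ⟨i, rfl⟩
    have h0 := Submodule.smul_mem _ a (hmem 0)
    have h1 := Submodule.smul_mem _ b (hmem 1)
    have h2 := Submodule.smul_mem _ c (hmem 2)
    simpa using add_mem (add_mem h0 h1) h2

end Field

/-! ### Orders and Hermite normal forms -/

section Lattice

variable {K : Type*} [Field K] [NumberField K]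

/-- The Hermite normal form with first basis vector `(1, 0, 0)`. -/
def unitalHermite (t : ℤ × ℤ × ℤ) : Matrix (Fin 3) (Fin 3) ℤ :=
  !![1, 0, 0; 0, t.1, 0; 0, t.2.1, t.2.2]

/-- Triples `(a, b, c)` with `a * c = N` for which the lattice of `unitalHermite (a, b, c)` is an
order. -/
def orderTriples (α : Fin 3 → K) (N : ℕ) : Set (ℤ × ℤ × ℤ) :=
  {t | 0 < t.1 ∧ 0 < t.2.2 ∧ 0 ≤ t.2.1 ∧ t.2.1 < t.1 ∧ t.1 * t.2.2 = N ∧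
    IsOrder (latticeOfMatrix α (unitalHermite t))}

theorem det_unitalHermite (t : ℤ × ℤ × ℤ) : (unitalHermite t).det = t.1 * t.2.2 := by
  simp [unitalHermite, Matrix.det_fin_three]

theorem unitalHermite_injective : Function.Injective unitalHermite := by
  rintro ⟨a, b, c⟩ ⟨a', b', c'⟩ H
  have h1 := congrFun (congrFun H 1) 1
  have h2 := congrFun (congrFun H 2) 1
  have h3 := congrFun (congrFun H 2) 2
  simp [unitalHermite] at h1 h2 h3
  rw [h1, h2, h3]

theorem one_mem_of_isOrder {L : Submodule ℤ K} (hL : IsOrder L) : (1 : K) ∈ L := by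
  obtain ⟨⟨S, hS⟩, -⟩ := hL
  have : (1 : K) ∈ (S : Set K) := S.one_mem
  rwa [hS] at this

theorem IsOrder.le_maximalOrder {L : Submodule ℤ K} (hL : IsOrder L) : L ≤ maximalOrder K := by
  obtain ⟨⟨S, hS⟩, hfg, -⟩ := hL
  intro x hx
  have hSL : Subalgebra.toSubmodule (subalgebraOfSubring S) = L := by
    apply SetLike.coe_injective
    rw [← hS]
    rfl
  have hxS : x ∈ subalgebraOfSubring S := by
    rw [← Subalgebra.mem_toSubmodule, hSL]
    exact hx
  exact IsIntegral.of_mem_of_fg (subalgebraOfSubring S) (by rw [hSL]; exact hfg) x hxS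

omit [NumberField K] in
theorem mem_latticeOfMatrix_iff {d : ℕ} {α : Fin d → K} {M : Matrix (Fin d) (Fin d) ℤ} {x : K} :
    x ∈ latticeOfMatrix α M ↔ ∃ c : Fin d → ℤ, ∑ i, c i • ∑ j, M i j • α j = x :=
  Submodule.mem_span_range_iff_exists_fun ℤ

theorem IsIntegralBasis.linearIndependent {d : ℕ} {α : Fin d → K} (hα : IsIntegralBasis α) :
    LinearIndependent ℚ α :=
  (LinearIndependent.iff_fractionRing ℤ ℚ).1 hα.1

omit [NumberField K] in
theorem IsIntegralBasis.eq_of_sum_eq {d : ℕ} {α : Fin d → K} (hα : IsIntegralBasis α)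
    {c c' : Fin d → ℤ} (h : ∑ i, c i • α i = ∑ i, c' i • α i) : c = c' := by
  funext i
  have := Fintype.linearIndependent_iff.1 hα.1 (c - c')
    (by simp only [Pi.sub_apply, sub_smul, Finset.sum_sub_distrib, h, sub_self]) i
  simpa [sub_eq_zero] using this

omit [NumberField K] in
theorem IsIntegralBasis.coord_unique {α : Fin 3 → K} (hα : IsIntegralBasis α)
    {x y z x' y' z' : ℤ} (h : x • α 0 + y • α 1 + z • α 2 = x' • α 0 + y' • α 1 + z' • α 2) :
    x = x' ∧ y = y' ∧ z = z' := by
  have := hα.eq_of_sum_eq (c := ![x, y, z]) (c' := ![x', y', z'])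
    (by simpa [Fin.sum_univ_three] using h)
  exact ⟨congrFun this 0, congrFun this 1, congrFun this 2⟩

omit [NumberField K] in
theorem IsIntegralBasis.latticeOfMatrix_le {d : ℕ} {α : Fin d → K} (hα : IsIntegralBasis α)
    (M : Matrix (Fin d) (Fin d) ℤ) : latticeOfMatrix α M ≤ maximalOrder K := by
  rw [← hα.2, latticeOfMatrix, Submodule.span_le]
  rintro _ ⟨i, rfl⟩
  exact sum_mem fun j _ => Submodule.smul_mem _ _ (Submodule.subset_span ⟨j, rfl⟩)

section Index

variable {d : ℕ} {α : Fin d → K} (hα : IsIntegralBasis α) (hd : Module.finrank ℚ K = d)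

include hα hd in
theorem IsIntegralBasis.exists_basis_of_det_ne_zero {M : Matrix (Fin d) (Fin d) ℤ}
    (hM : M.det ≠ 0) : ∃ b₁ b₂ : Module.Basis (Fin d) ℚ K, (⇑b₂ = α) ∧
      (⇑b₁ = fun i => ∑ j, M i j • α j) ∧ b₂.det b₁ = M.det := by
  have : Nonempty (Fin d) := by
    rw [← hd]
    exact ⟨⟨0, Module.finrank_pos⟩⟩
  let b₂ := basisOfLinearIndependentOfCardEqFinrank hα.linearIndependent (by simp [hd])
  have hb₂ : ⇑b₂ = α := coe_basisOfLinearIndependentOfCardEqFinrank _ _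
  have hdet : b₂.det (fun i => ∑ j, M i j • α j) = M.det := by
    have hmat : b₂.toMatrix (fun i => ∑ j, M i j • α j) = (M.map (Int.cast : ℤ → ℚ)).transpose := by
      ext i j
      rw [Module.Basis.toMatrix_apply, ← hb₂]
      simp only [← Int.cast_smul_eq_zsmul ℚ, map_sum, map_smul, b₂.repr_self]
      simp [Finsupp.single_apply]
    rw [Module.Basis.det_apply, hmat, Matrix.det_transpose]
    exact (RingHom.map_det (Int.castRingHom ℚ) M).symm
  have hunit : IsUnit (b₂.det (fun i => ∑ j, M i j • α j)) := by
    rw [hdet, isUnit_iff_ne_zero]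
    exact_mod_cast hM
  obtain ⟨hli, hsp⟩ := (Module.Basis.is_basis_iff_det b₂).2 hunit
  refine ⟨Module.Basis.mk hli hsp.ge, b₂, hb₂, Module.Basis.coe_mk _ _, ?_⟩
  rw [Module.Basis.coe_mk, hdet]

include hα hd in
theorem IsIntegralBasis.relIndex_latticeOfMatrix {M : Matrix (Fin d) (Fin d) ℤ} (hM : M.det ≠ 0) :
    (((latticeOfMatrix α M).toAddSubgroup.relIndex (maximalOrder K).toAddSubgroup : ℕ) : ℤ) =
      |M.det| := by
  obtain ⟨b₁, b₂, h₂, h₁, hdet⟩ := hα.exists_basis_of_det_ne_zero hd hM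
  have := AddSubgroup.relIndex_eq_abs_det (latticeOfMatrix α M).toAddSubgroup
    (maximalOrder K).toAddSubgroup (hα.latticeOfMatrix_le M) b₁ b₂
    (by rw [h₁, latticeOfMatrix, Submodule.span_int_eq_addSubgroupClosure])
    (by rw [h₂, ← hα.2, Submodule.span_int_eq_addSubgroupClosure])
  rw [hdet] at this
  exact_mod_cast this

include hα hd in
theorem IsIntegralBasis.isOrder_latticeOfMatrix_iff {M : Matrix (Fin d) (Fin d) ℤ}
    (hM : M.det ≠ 0) : IsOrder (latticeOfMatrix α M) ↔
      1 ∈ latticeOfMatrix α M ∧ ∀ i i', (∑ j, M i j • α j) * (∑ j, M i' j • α j) ∈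
        latticeOfMatrix α M := by
  constructor
  · intro H
    refine ⟨one_mem_of_isOrder H, fun i i' => ?_⟩
    obtain ⟨⟨S, hS⟩, -⟩ := H
    have hmem : ∀ i, ∑ j, M i j • α j ∈ (S : Set K) := fun i => by
      rw [hS]
      exact Submodule.subset_span ⟨i, rfl⟩
    have := S.mul_mem (hmem i) (hmem i')
    rwa [← SetLike.mem_coe, hS] at this
  · rintro ⟨h1, hmul⟩
    have hclosed : latticeOfMatrix α M * latticeOfMatrix α M ≤ latticeOfMatrix α M := by
      conv_lhs => rw [latticeOfMatrix, Submodule.span_mul_span]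
      rw [Submodule.span_le]
      rintro _ ⟨_, ⟨i, rfl⟩, _, ⟨i', rfl⟩, rfl⟩
      exact hmul i i'
    refine ⟨⟨{ carrier := latticeOfMatrix α M
               mul_mem' := fun ha hb => hclosed (Submodule.mul_mem_mul ha hb)
               one_mem' := h1
               add_mem' := add_mem
               zero_mem' := zero_mem _
               neg_mem' := neg_mem }, rfl⟩, Submodule.fg_span (Set.finite_range _), ?_⟩
    obtain ⟨b₁, -, -, h₁, -⟩ := hα.exists_basis_of_det_ne_zero hd hM
    have hli : LinearIndependent ℤ (fun i => ∑ j, M i j • α j) := by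
      rw [← h₁]
      exact b₁.linearIndependent.restrict_scalars' ℤ
    rw [latticeOfMatrix, finrank_span_eq_card hli, hd, Fintype.card_fin]

end Index

variable {α : Fin 3 → K} (hα : IsIntegralBasis α) (h0 : α 0 = 1)
  (hd : Module.finrank ℚ K = 3)

omit [NumberField K] in
theorem mem_latticeOfMatrix_unitalHermite {t : ℤ × ℤ × ℤ} {x : K} :
    x ∈ latticeOfMatrix α (unitalHermite t) ↔ ∃ r s u : ℤ,
      x = r • α 0 + (s * t.1 + u * t.2.1) • α 1 + (u * t.2.2) • α 2 := by
  have key : ∀ c : Fin 3 → ℤ, ∑ i, c i • ∑ j, unitalHermite t i j • α j =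
      c 0 • α 0 + (c 1 * t.1 + c 2 * t.2.1) • α 1 + (c 2 * t.2.2) • α 2 := by
    intro c
    simp [Fin.sum_univ_three, unitalHermite]
    ring
  rw [mem_latticeOfMatrix_iff]
  constructor
  · rintro ⟨c, rfl⟩
    exact ⟨c 0, c 1, c 2, key c⟩
  · rintro ⟨r, s, u, rfl⟩
    exact ⟨![r, s, u], key _⟩

omit [NumberField K] in
include hα in
theorem IsIntegralBasis.mem_latticeOfMatrix_unitalHermite_iff {t : ℤ × ℤ × ℤ} {x y z : ℤ} :
    x • α 0 + y • α 1 + z • α 2 ∈ latticeOfMatrix α (unitalHermite t) ↔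
      ∃ u, z = u * t.2.2 ∧ t.1 ∣ y - u * t.2.1 := by
  rw [mem_latticeOfMatrix_unitalHermite]
  constructor
  · rintro ⟨r, s, u, H⟩
    obtain ⟨-, rfl, rfl⟩ := hα.coord_unique H
    exact ⟨u, rfl, s, by ring⟩
  · rintro ⟨u, rfl, s, hs⟩
    exact ⟨x, s, u, by rw [show y = s * t.1 + u * t.2.1 by linear_combination hs]⟩

include hα in
-- The lattice determines a through the multiples of `α 1` in it, c through the last coordinates,
-- and then b modulo a.
theorem IsIntegralBasis.injOn_latticeOfMatrix_unitalHermite (N : ℕ) :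
    Set.InjOn (fun t => latticeOfMatrix α (unitalHermite t)) (orderTriples α N) := by
  rintro ⟨a, b, c⟩ ⟨ha, hc, hb, hba, -, -⟩ ⟨a', b', c'⟩ ⟨ha', hc', hb', hba', -, -⟩ H
  dsimp only at ha hc hb hba ha' hc' hb' hba' H
  have h1 : ∀ {y z : ℤ}, (∃ u, z = u * c ∧ a ∣ y - u * b) ↔ ∃ u, z = u * c' ∧ a' ∣ y - u * b' := by
    intro y z
    rw [← hα.mem_latticeOfMatrix_unitalHermite_iff (t := (a, b, c)) (x := 0),
      ← hα.mem_latticeOfMatrix_unitalHermite_iff (t := (a', b', c')) (x := 0), H]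
  have haa' : a' ∣ a := by
    obtain ⟨u, hu, hd⟩ := h1.1 (⟨0, by simp, by simp⟩ : ∃ u, (0 : ℤ) = u * c ∧ a ∣ a - u * b)
    obtain rfl : u = 0 := (mul_eq_zero.1 hu.symm).resolve_right hc'.ne'
    simpa using hd
  have ha'a : a ∣ a' := by
    obtain ⟨u, hu, hd⟩ := h1.2 (⟨0, by simp, by simp⟩ : ∃ u, (0 : ℤ) = u * c' ∧ a' ∣ a' - u * b')
    obtain rfl : u = 0 := (mul_eq_zero.1 hu.symm).resolve_right hc.ne'
    simpa using hd
  obtain rfl : a = a' := Int.dvd_antisymm ha.le ha'.le ha'a haa'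
  obtain ⟨u, hu, hdu⟩ := h1.1 (⟨1, by simp, by simp⟩ : ∃ u, c = u * c ∧ a ∣ b - u * b)
  obtain ⟨v, hv, -⟩ := h1.2 (⟨1, by simp, by simp⟩ : ∃ u, c' = u * c' ∧ a ∣ b' - u * b')
  obtain rfl : c = c' := Int.dvd_antisymm hc.le hc'.le ⟨v, by linarith⟩ ⟨u, by linarith⟩
  obtain rfl : u = 1 := by
    have : (u - 1) * c = 0 := by linarith
    exact sub_eq_zero.1 ((mul_eq_zero.1 this).resolve_right hc.ne')
  rw [one_mul] at hdu
  have hbb : b = b' := by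
    have h3 : b % a = b' % a := Int.emod_eq_emod_iff_emod_sub_eq_zero.2 (Int.emod_eq_zero_of_dvd hdu)
    rwa [Int.emod_eq_of_lt hb hba, Int.emod_eq_of_lt hb' hba'] at h3
  rw [hbb]

include hα h0 in
theorem IsIntegralBasis.hermiteOrders_eq_image {N : ℕ} (hN : N ≠ 0) :
    hermiteOrders α N = unitalHermite '' orderTriples α N := by
  ext M
  constructor
  · rintro ⟨⟨hnn, hup, hlt⟩, hdet, hord⟩
    have h01 := hup 0 1 (by decide)
    have h02 := hup 0 2 (by decide)
    have h12 := hup 1 2 (by decide)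
    have hdet' : M 0 0 * M 1 1 * M 2 2 = N := by
      rw [← hdet, Matrix.det_fin_three, h01, h02, h12]
      ring
    have hne : M 0 0 * M 1 1 * M 2 2 ≠ 0 := by
      rw [hdet']
      exact_mod_cast hN
    have hd1 : M 1 1 ≠ 0 := right_ne_zero_of_mul (left_ne_zero_of_mul hne)
    have hd2 : M 2 2 ≠ 0 := right_ne_zero_of_mul hne
    -- Writing 1 in the rows, triangularity kills the last two coefficients, so `M 0 0` is a unit;
    -- the entries below it are then reduced modulo 1.
    obtain ⟨c, hc⟩ := mem_latticeOfMatrix_iff.1 (one_mem_of_isOrder hord)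
    have hc' : (c 0 * M 0 0 + c 1 * M 1 0 + c 2 * M 2 0) • α 0 +
        (c 1 * M 1 1 + c 2 * M 2 1) • α 1 + (c 2 * M 2 2) • α 2 =
          (1 : ℤ) • α 0 + (0 : ℤ) • α 1 + (0 : ℤ) • α 2 := by
      simp only [Fin.sum_univ_three, h01, h02, h12] at hc
      rw [one_smul, zero_smul, zero_smul, add_zero, add_zero]
      refine Eq.trans ?_ (hc.trans h0.symm)
      module
    obtain ⟨e0, e1, e2⟩ := hα.coord_unique hc'
    have hc2 : c 2 = 0 := (mul_eq_zero.1 e2).resolve_right hd2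
    rw [hc2, zero_mul, add_zero] at e1 e0
    have hc1 : c 1 = 0 := (mul_eq_zero.1 e1).resolve_right hd1
    rw [hc1, zero_mul, add_zero] at e0
    have h00 : M 0 0 = 1 := by
      rcases Int.isUnit_iff.1 (IsUnit.of_mul_eq_one_right _ e0) with H | H
      · exact H
      · have := hnn 0 0
        omega
    have h10 : M 1 0 = 0 := by
      have := hlt 1 0 (by decide)
      have := hnn 1 0
      omega
    have h20 : M 2 0 = 0 := by
      have := hlt 2 0 (by decide)
      have := hnn 2 0
      omega
    have hM : unitalHermite (M 1 1, M 2 1, M 2 2) = M := by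
      ext i j
      fin_cases i <;> fin_cases j <;> simp [unitalHermite, *]
    refine ⟨_, ⟨lt_of_le_of_ne (hnn 1 1) hd1.symm, lt_of_le_of_ne (hnn 2 2) hd2.symm, hnn 2 1,
      hlt 2 1 (by decide), ?_, ?_⟩, hM⟩
    · rw [← hdet', h00, one_mul]
    · rw [hM]
      exact hord
  · rintro ⟨t, ⟨ha, hc, hb, hba, hac, hord⟩, rfl⟩
    refine ⟨⟨?_, ?_, ?_⟩, ?_, hord⟩
    · intro i j
      fin_cases i <;> fin_cases j <;> simp [unitalHermite] <;> omega
    · intro i j hij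
      fin_cases i <;> fin_cases j <;> simp [unitalHermite] at hij ⊢
    · intro i j hij
      fin_cases i <;> fin_cases j <;> simp [unitalHermite] at hij ⊢ <;> omega
    · rw [det_unitalHermite, hac]

omit [NumberField K] in
include hα h0 in
-- Here a generates the ideal of x with x • `α 1` in L, and c that of x with x • `α 2` in L + ℤ `α
-- 1`. Both ideals contain N, so they are nonzero.
theorem IsIntegralBasis.exists_unitalHermite {L : Submodule ℤ K} (hL : L ≤ maximalOrder K)
    (h1 : (1 : K) ∈ L) {N : ℤ} (hN : N ≠ 0) (hNL : ∀ x ∈ maximalOrder K, N • x ∈ L) :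
    ∃ t : ℤ × ℤ × ℤ, 0 < t.1 ∧ 0 < t.2.2 ∧ 0 ≤ t.2.1 ∧ t.2.1 < t.1 ∧
      L = latticeOfMatrix α (unitalHermite t) := by
  have hmem : ∀ i, α i ∈ maximalOrder K := fun i => by
    rw [← hα.2]
    exact Submodule.subset_span ⟨i, rfl⟩
  have hgen : ∀ (I : Submodule ℤ ℤ), N ∈ I → ∃ g : ℤ, 0 < g ∧ ∀ x, x ∈ I ↔ g ∣ x := by
    intro I hI
    have hspan : ∀ x, x ∈ I ↔ Submodule.IsPrincipal.generator I ∣ x := fun x => by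
      rw [Submodule.IsPrincipal.mem_iff_eq_smul_generator I]
      exact ⟨fun ⟨s, hs⟩ => ⟨s, by rw [hs, smul_eq_mul, mul_comm]⟩,
        fun ⟨s, hs⟩ => ⟨s, by rw [smul_eq_mul, mul_comm]; exact hs⟩⟩
    refine ⟨|Submodule.IsPrincipal.generator I|, abs_pos.2 fun H => ?_, fun x => ?_⟩
    · rw [hspan, H, zero_dvd_iff] at hI
      exact hN hI
    · rw [hspan, abs_dvd]
  obtain ⟨a, ha, haI⟩ := hgen (L.comap (LinearMap.toSpanSingleton ℤ K (α 1))) (by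
    simpa using hNL _ (hmem 1))
  obtain ⟨c, hc, hcI⟩ := hgen ((L ⊔ Submodule.span ℤ {α 1}).comap
    (LinearMap.toSpanSingleton ℤ K (α 2))) (by
      simpa using Submodule.mem_sup_left (hNL _ (hmem 2)))
  simp only [Submodule.mem_comap, LinearMap.toSpanSingleton_apply] at haI hcI
  obtain ⟨l, hl, w, hw, hlw⟩ := Submodule.mem_sup.1 ((hcI c).2 dvd_rfl)
  obtain ⟨b₀, rfl⟩ := Submodule.mem_span_singleton.1 hw
  have hv : (-b₀ % a) • α 1 + c • α 2 ∈ L := by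
    have h2 := Submodule.smul_mem L (-b₀ / a) ((haI a).2 dvd_rfl)
    have h3 := sub_mem hl h2
    have h4 : -b₀ % a = -b₀ - a * (-b₀ / a) := Int.emod_def _ _
    convert h3 using 1
    rw [h4, ← hlw, smul_smul]
    module
  refine ⟨(a, -b₀ % a, c), ha, hc, Int.emod_nonneg _ ha.ne', Int.emod_lt_of_pos _ ha, ?_⟩
  apply le_antisymm
  · intro x hx
    have hx' := hL hx
    rw [← hα.2] at hx'
    obtain ⟨e, rfl⟩ := (Submodule.mem_span_range_iff_exists_fun ℤ).1 hx'
    rw [Fin.sum_univ_three] at hx ⊢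
    rw [hα.mem_latticeOfMatrix_unitalHermite_iff]
    have h2 : e 1 • α 1 + e 2 • α 2 ∈ L := by
      have := sub_mem hx (Submodule.smul_mem L (e 0) h1)
      rw [h0] at this
      convert this using 1
      module
    obtain ⟨u, hu⟩ := (hcI (e 2)).1 (by
      have h3 : e 1 • α 1 ∈ Submodule.span ℤ {α 1} :=
        Submodule.smul_mem _ _ (Submodule.mem_span_singleton_self _)
      have := sub_mem (Submodule.mem_sup_left (T := Submodule.span ℤ {α 1}) h2)
        (Submodule.mem_sup_right (S := L) h3)
      convert this using 1
      module)
    refine ⟨u, by rw [hu, mul_comm], (haI _).1 ?_⟩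
    have := sub_mem h2 (Submodule.smul_mem L u hv)
    convert this using 1
    rw [hu]
    module
  · intro x hx
    obtain ⟨r, s, u, rfl⟩ := mem_latticeOfMatrix_unitalHermite.1 hx
    have h2 := Submodule.smul_mem L s ((haI a).2 dvd_rfl)
    have h3 := Submodule.smul_mem L u hv
    have h4 := Submodule.smul_mem L r h1
    have := add_mem (add_mem h4 h2) h3
    convert this using 1
    rw [h0]
    dsimp only
    module

include hα h0 hd in
theorem IsIntegralBasis.ordersOfIndex_eq_image {N : ℕ} (hN : N ≠ 0) :
    ordersOfIndex K N =
      (fun t => latticeOfMatrix α (unitalHermite t)) '' orderTriples α N := by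
  ext L
  constructor
  · rintro ⟨hord, hidx⟩
    have hNL : ∀ x ∈ maximalOrder K, (N : ℤ) • x ∈ L := by
      intro x hx
      have := AddSubgroup.nsmul_relIndex_mem L.toAddSubgroup
        (K := (maximalOrder K).toAddSubgroup) (g := x) hx
      rw [hidx] at this
      rw [natCast_zsmul]
      exact this
    obtain ⟨t, ha, hc, hb, hba, rfl⟩ := hα.exists_unitalHermite h0 hord.le_maximalOrder
      (one_mem_of_isOrder hord) (by exact_mod_cast hN) hNL
    refine ⟨t, ⟨ha, hc, hb, hba, ?_, hord⟩, rfl⟩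
    have hpos : 0 < t.1 * t.2.2 := mul_pos ha hc
    have := hα.relIndex_latticeOfMatrix hd (M := unitalHermite t)
      (by rw [det_unitalHermite]; exact hpos.ne')
    rw [hidx, det_unitalHermite, abs_of_pos hpos] at this
    exact this.symm
  · rintro ⟨t, ⟨ha, hc, hb, hba, hac, hord⟩, rfl⟩
    refine ⟨hord, ?_⟩
    have hpos : 0 < t.1 * t.2.2 := mul_pos ha hc
    have := hα.relIndex_latticeOfMatrix hd (M := unitalHermite t)
      (by rw [det_unitalHermite]; exact hpos.ne')
    rw [det_unitalHermite, abs_of_pos hpos, hac] at this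
    exact_mod_cast this

end Lattice

/-! ### Closure in the pure cubic basis -/

section PureCubic

variable {K : Type*} [Field K] [NumberField K] {α : Fin 3 → K} (hα : IsIntegralBasis α)
  (h0 : α 0 = 1) (hd : Module.finrank ℚ K = 3) {h k : ℤ} (h11 : α 1 ^ 2 = k * α 2)
  (h12 : α 1 * α 2 = h * k) (h22 : α 2 ^ 2 = h * α 1)

include hα h0 hd h11 h12 h22 in
-- Only three products of generators matter. Writing a²k = uc, abk = vc, b²k = wc, one gets ub = av
-- and vb = aw, so the `α 1` coordinate is a constraint only for the last square, where multiplying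
-- by c gives the fourth condition.
theorem isOrder_unitalHermite_iff_cubicClosed {a b c : ℤ} (ha : 0 < a) (hc : 0 < c) :
    IsOrder (latticeOfMatrix α (unitalHermite (a, b, c))) ↔ CubicClosed h k a b c := by
  have hdet : (unitalHermite (a, b, c)).det ≠ 0 := by
    rw [det_unitalHermite]
    exact (mul_pos ha hc).ne'
  rw [hα.isOrder_latticeOfMatrix_iff hd hdet]
  have hv0 : ∑ j, unitalHermite (a, b, c) 0 j • α j = 1 := by
    simp [Fin.sum_univ_three, unitalHermite, h0]
  have hv1 : ∑ j, unitalHermite (a, b, c) 1 j • α j = a * α 1 := by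
    simp [Fin.sum_univ_three, unitalHermite]
  have hv2 : ∑ j, unitalHermite (a, b, c) 2 j • α j = b * α 1 + c * α 2 := by
    simp [Fin.sum_univ_three, unitalHermite]
  have hmem : ∀ i, ∑ j, unitalHermite (a, b, c) i j • α j ∈
      latticeOfMatrix α (unitalHermite (a, b, c)) := fun i => Submodule.subset_span ⟨i, rfl⟩
  have m11 : ((a : K) * α 1) * (a * α 1) ∈ latticeOfMatrix α (unitalHermite (a, b, c)) ↔
      ∃ u, a ^ 2 * k = u * c ∧ a ∣ 0 - u * b := by
    rw [← hα.mem_latticeOfMatrix_unitalHermite_iff (t := (a, b, c)) (x := 0)]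
    congr! 1
    simp
    linear_combination (a : K) ^ 2 * h11
  have m12 : ((a : K) * α 1) * (b * α 1 + c * α 2) ∈
      latticeOfMatrix α (unitalHermite (a, b, c)) ↔ ∃ u, a * b * k = u * c ∧ a ∣ 0 - u * b := by
    rw [← hα.mem_latticeOfMatrix_unitalHermite_iff (t := (a, b, c)) (x := a * c * (h * k))]
    congr! 1
    simp [h0]
    linear_combination (a : K) * b * h11 + a * c * h12
  have m22 : ((b : K) * α 1 + c * α 2) * (b * α 1 + c * α 2) ∈
      latticeOfMatrix α (unitalHermite (a, b, c)) ↔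
        ∃ u, b ^ 2 * k = u * c ∧ a ∣ c ^ 2 * h - u * b := by
    rw [← hα.mem_latticeOfMatrix_unitalHermite_iff (t := (a, b, c)) (x := 2 * b * c * (h * k))]
    congr! 1
    simp [h0]
    linear_combination (b : K) ^ 2 * h11 + 2 * b * c * h12 + c ^ 2 * h22
  constructor
  · rintro ⟨-, hmul⟩
    have e11 := hmul 1 1
    have e12 := hmul 1 2
    have e22 := hmul 2 2
    rw [hv1, m11] at e11
    rw [hv1, hv2, m12] at e12
    rw [hv2, m22] at e22
    obtain ⟨u, hu, -⟩ := e11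
    obtain ⟨v, hv, -⟩ := e12
    obtain ⟨w, hw, x, hx⟩ := e22
    exact ⟨⟨u, by linarith⟩, ⟨v, by linarith⟩, ⟨w, by linarith⟩,
      ⟨-x, by linear_combination b * hw - c * hx⟩⟩
  · rintro ⟨⟨u, hu⟩, ⟨v, hv⟩, ⟨w, hw⟩, ⟨x, hx⟩⟩
    have e11 : ((a : K) * α 1) * (a * α 1) ∈ latticeOfMatrix α (unitalHermite (a, b, c)) :=
      m11.2 ⟨u, by linarith, -v, mul_left_cancel₀ hc.ne' (by linear_combination b * hu - a * hv)⟩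
    have e12 : ((a : K) * α 1) * (b * α 1 + c * α 2) ∈
        latticeOfMatrix α (unitalHermite (a, b, c)) :=
      m12.2 ⟨v, by linarith, -w, mul_left_cancel₀ hc.ne' (by linear_combination b * hv - a * hw)⟩
    have e22 : ((b : K) * α 1 + c * α 2) * (b * α 1 + c * α 2) ∈
        latticeOfMatrix α (unitalHermite (a, b, c)) :=
      m22.2 ⟨w, by linarith, -x, mul_left_cancel₀ hc.ne' (by linear_combination b * hw - hx)⟩
    have h1 := hmem 0
    rw [hv0] at h1
    refine ⟨h1, fun i i' => ?_⟩
    fin_cases i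
    · change (∑ j, unitalHermite (a, b, c) 0 j • α j) * _ ∈ _
      rw [hv0, one_mul]
      exact hmem i'
    · change (∑ j, unitalHermite (a, b, c) 1 j • α j) * _ ∈ _
      fin_cases i'
      · change _ * (∑ j, unitalHermite (a, b, c) 0 j • α j) ∈ _
        rw [hv0, mul_one]
        exact hmem 1
      · change _ * (∑ j, unitalHermite (a, b, c) 1 j • α j) ∈ _
        rwa [hv1]
      · change _ * (∑ j, unitalHermite (a, b, c) 2 j • α j) ∈ _
        rwa [hv1, hv2]
    · change (∑ j, unitalHermite (a, b, c) 2 j • α j) * _ ∈ _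
      fin_cases i'
      · change _ * (∑ j, unitalHermite (a, b, c) 0 j • α j) ∈ _
        rw [hv0, mul_one]
        exact hmem 2
      · change _ * (∑ j, unitalHermite (a, b, c) 1 j • α j) ∈ _
        rwa [hv1, hv2, mul_comm]
      · change _ * (∑ j, unitalHermite (a, b, c) 2 j • α j) ∈ _
        rwa [hv2]

include hα h0 hd h11 h12 h22 in
theorem orderTriples_prime_pow {p : ℕ} (hp : p.Prime) (n : ℕ) :
    (orderTriples α (p ^ n)).Finite ∧ (orderTriples α (p ^ n)).ncard = cubicClosedCount h k p n := by
  classical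
  have hpZ : (0 : ℤ) < p := by exact_mod_cast hp.pos
  set F : Finset (Σ _ : ℕ, ℕ) := (Finset.range (n + 1)).sigma fun i =>
    (Finset.range (p ^ i)).filter fun b : ℕ =>
      CubicClosed h k ((p : ℤ) ^ i) b ((p : ℤ) ^ (n - i)) with hF
  set f : (Σ _ : ℕ, ℕ) → ℤ × ℤ × ℤ := fun x => ((p : ℤ) ^ x.1, (x.2 : ℤ), (p : ℤ) ^ (n - x.1))
    with hf
  have hinj : Function.Injective f := by
    rintro ⟨i, b⟩ ⟨i', b'⟩ H
    simp only [hf, Prod.mk.injEq, Nat.cast_inj] at H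
    obtain ⟨h1, rfl, -⟩ := H
    obtain rfl := Nat.pow_right_injective hp.two_le (show p ^ i = p ^ i' by exact_mod_cast h1)
    rfl
  have himage : orderTriples α (p ^ n) = ((F.image f : Finset _) : Set (ℤ × ℤ × ℤ)) := by
    ext ⟨a, b, c⟩
    simp only [Finset.coe_image, Set.mem_image, Finset.mem_coe, hF, Finset.mem_sigma,
      Finset.mem_filter, Finset.mem_range]
    constructor
    · rintro ⟨ha, hc, hb, hba, hac, hord⟩
      dsimp only at ha hc hb hba hac
      rw [isOrder_unitalHermite_iff_cubicClosed hα h0 hd h11 h12 h22 ha hc] at hord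
      lift a to ℕ using ha.le
      lift b to ℕ using hb
      lift c to ℕ using hc.le
      have hac' : a * c = p ^ n := by exact_mod_cast hac
      obtain ⟨i, hi, rfl⟩ := (Nat.dvd_prime_pow hp).1 (Dvd.intro _ hac')
      have hc' : c = p ^ (n - i) := by
        apply Nat.eq_of_mul_eq_mul_left (pow_pos hp.pos i)
        rw [hac', ← pow_add, Nat.add_sub_cancel' hi]
      subst hc'
      push_cast at hord
      exact ⟨⟨i, b⟩, ⟨Nat.lt_succ_of_le hi, by exact_mod_cast hba, hord⟩, by simp [hf]⟩
    · rintro ⟨⟨i, b'⟩, ⟨hi, hb, hcl⟩, H⟩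
      dsimp only at hi hb hcl
      simp only [hf, Prod.mk.injEq] at H
      obtain ⟨rfl, rfl, rfl⟩ := H
      refine ⟨pow_pos hpZ _, pow_pos hpZ _, Int.natCast_nonneg _, ?_, ?_, ?_⟩
      · dsimp only
        exact_mod_cast hb
      · dsimp only
        rw [← pow_add, Nat.add_sub_cancel' (Nat.le_of_lt_succ hi)]
        push_cast
        rfl
      · exact (isOrder_unitalHermite_iff_cubicClosed hα h0 hd h11 h12 h22 (pow_pos hpZ _)
          (pow_pos hpZ _)).2 hcl
  rw [himage]
  refine ⟨Finset.finite_toSet _, ?_⟩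
  rw [Set.ncard_coe_finset, Finset.card_image_of_injective _ hinj, hF, Finset.card_sigma]
  rfl

end PureCubic

theorem theorem2p5 {K : Type*} [Field K] [NumberField K]
    (m h k : ℤ) (hcube : ∀ d : ℤ, d ^ 3 ∣ m → IsUnit d)
    (hm9 : ¬ m ^ 2 ≡ 1 [ZMOD 9])
    (hmhk : m = h * k ^ 2) (hh : Squarefree h) (hk : Squarefree k) (hhk : IsCoprime h k)
    (θ : K) (hθ : θ ^ 3 = (m : K)) (hK : IntermediateField.adjoin ℚ {θ} = ⊤)
    (p : ℕ) (hp : p.Prime) (hp2 : p ≠ 2) (hp3 : p ≠ 3) (n : ℕ) :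
    ((ordersOfIndex K (p ^ n)).Finite ∧
      ((ordersOfIndex K (p ^ n)).ncard : ℚ) = pureCubicOrderCount m p n) ∧
    IsIntegralBasis ![1, θ, θ ^ 2 / (k : K)] ∧
    ∀ α : Fin 3 → K, IsIntegralBasis α → α 0 = 1 →
      (hermiteOrders α (p ^ n)).Finite ∧
        ((hermiteOrders α (p ^ n)).ncard : ℚ) = pureCubicOrderCount m p n := by
  have hN : p ^ n ≠ 0 := pow_ne_zero n hp.ne_zero
  have hd : Module.finrank ℚ K = 3 := by
    rw [← natDegree_minpoly_of_pow_three_eq hcube hm9 hθ,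
      ← IntermediateField.adjoin.finrank (Algebra.IsIntegral.isIntegral θ), hK,
      IntermediateField.finrank_top']
  have hbasis := isIntegralBasis_pureCubic hcube hm9 hmhk hh hk hhk hθ hd
  have hkK : (k : K) ≠ 0 := by exact_mod_cast hk.ne_zero
  have hθ' : θ ^ 3 = h * k ^ 2 := by rw [hθ, hmhk]; push_cast; rfl
  have htriples := orderTriples_prime_pow hbasis rfl hd (h := h) (k := k)
    (by simp; field_simp) (by simp; field_simp; linear_combination hθ')
    (by simp; field_simp; linear_combination θ * hθ') hp n
  have horders : (ordersOfIndex K (p ^ n)).Finite ∧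
      ((ordersOfIndex K (p ^ n)).ncard : ℚ) = pureCubicOrderCount m p n := by
    rw [hbasis.ordersOfIndex_eq_image rfl hd hN]
    refine ⟨htriples.1.image _, ?_⟩
    rw [(hbasis.injOn_latticeOfMatrix_unitalHermite _).ncard_image, htriples.2,
      cubicClosedCount_eq hp hp3 hh hk hhk, hmhk]
  refine ⟨horders, hbasis, fun α hα h0 => ?_⟩
  -- The count of orders, known from the explicit basis, is read back as a count of triples for the
  -- given one.
  rw [hα.ordersOfIndex_eq_image h0 hd hN, (hα.injOn_latticeOfMatrix_unitalHermite _).ncard_image,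
    Set.finite_image_iff (hα.injOn_latticeOfMatrix_unitalHermite _)] at horders
  rw [hα.hermiteOrders_eq_image h0 hN, Set.ncard_image_of_injective _ unitalHermite_injective]
  exact ⟨horders.1.image _, horders.2⟩
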